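/- Let $A$ be an artin algebra, i.e. an algebra over a commutative artinian ring $R$ that is finitely generated as an $R$-module, and let $A\text{-mod}$ be the category of finitely generated left $A$-modules. Let $S$ be a \emph{localizable} simple $A$-module, that is, a simple $A$-module with $\operatorname{proj.dim}_A S\le 1$ and $\operatorname{Ext}^1_A(S,S)=0$. Let $$S^{\perp}=\{X\in A\text{-mod}\mid \operatorname{Hom}_A(S,X)=0=\operatorname{Ext}^1_A(S,X)\},$$ let $i\colon S^\perp\to A\text{-mod}$ be the inclusion, $i_\lambda\colon A\text{-mod}\to S^\perp$ its left adjoint (which exists), $\eta\colon \mathrm{Id}\to L=i\,i_\lambda$ the unit of the adjunction, and $\eta_A\colon A\to L(A)$ its value at the regular module $A$. For $Y\in S^\perp$ and $y\in Y$, let $\hat r_y\colon L(A)\to Y$ be the unique $A$-linear map with $\hat r_y(\eta_A(a))=a.y$ for all $a\in A$. Then $L(A)$ is a ring with multiplication $x\star y=\hat r_y(x)$, the map $\eta_A\colon A\to L(A)$ is a ring homomorphism (the \emph{left retraction} associated to $S$), and each $Y\in S^\perp$ is an $L(A)$-module via $x.y=\hat r_y(x)$; in this way $S^\perp$ is identified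 with $L(A)\text{-mod}$. Call an artin algebra $B$ \emph{Gorenstein} if the regular module $B$ has finite injective dimension both as a left and as a right $B$-module. Let $I$ be the injective envelope of $S$ in $A\text{-mod}$. Then $A$ is Gorenstein if and only if $L(A)$ is Gorenstein and $\operatorname{proj.dim}_{L(A)} i_\lambda(I)<\infty$. -/

import Mathlib

open CategoryTheory Abelian

universe u

/-- `A` is an artin algebra: an algebra over some commutative artinian ring `R`, finitely generated
as an `R`-module. (Replacing `R` by its image in `A`, one may take `R` in the universe of `A`.) -/
class IsArtinAlgebra (A : Type u) [Ring A] : Prop where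
  exists_base : ∃ (R : Type u) (_ : CommRing R) (_ : Algebra R A),
    IsArtinianRing R ∧ Module.Finite R A

/-- A simple `A`-module `S` is localizable if `proj.dim S ≤ 1` and `Ext¹(S, S) = 0`. -/
class IsLocalizable (A : Type u) [Ring A] (S : Type u) [AddCommGroup S] [Module A S] : Prop where
  isSimple : IsSimpleModule A S
  projectiveDimension_le_one : projectiveDimension (ModuleCat.of A S) ≤ 1
  subsingleton_ext_one : Subsingleton (Ext (ModuleCat.of A S) (ModuleCat.of A S) 1)

/-- An artin algebra `A` is Gorenstein if the regular module has finite injective dimension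
on both sides (right modules are modules over `Aᵐᵒᵖ`). -/
def IsGorenstein (A : Type u) [Ring A] : Prop :=
  injectiveDimension (ModuleCat.of.{u} A A) < ⊤ ∧
    injectiveDimension (ModuleCat.of.{u} Aᵐᵒᵖ A) < ⊤

/-- `ι : M → I` is an injective envelope: `I` is injective and `ι` is an essential embedding. -/
structure IsInjectiveEnvelope {A : Type u} [Ring A] {M I : Type u} [AddCommGroup M] [Module A M]
    [AddCommGroup I] [Module A I] (ι : M →ₗ[A] I) : Prop where
  moduleInjective : Module.Injective A I
  injective : Function.Injective ι
  essential : ∀ N : Submodule A I, N ⊓ LinearMap.range ι = ⊥ → N = ⊥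

/-- The objects `X` of the category of finitely generated `A`-modules with
`Hom(S, X) = 0 = Ext¹(S, X)`. -/
def perp (A : Type u) [Ring A] (S : Type u) [AddCommGroup S] [Module A S] :
    ObjectProperty (FGModuleCat.{u} A) := fun X =>
  Subsingleton (S →ₗ[A] X) ∧ Subsingleton (Ext (ModuleCat.of A S) X.obj 1)

/-- The perpendicular subcategory `S^⊥` of the category of finitely generated `A`-modules. -/
abbrev PerpCat (A : Type u) [Ring A] (S : Type u) [AddCommGroup S] [Module A S] :=
  (perp A S).FullSubcategory

/-- The inclusion functor `i : S^⊥ ⥤ A-mod`. -/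
abbrev perpInclusion (A : Type u) [Ring A] (S : Type u) [AddCommGroup S] [Module A S] :
    PerpCat A S ⥤ FGModuleCat.{u} A :=
  (perp A S).ι

/-! The inclusion `i` has a left adjoint, by the construction of the universal map to `S^⊥`. -/

section Reflection

variable {A : Type u} [Ring A]

/-- Every homomorphism from the left ideal `K` to `X` extends to `A`. -/
def ExtendsFrom (K : Submodule A A) (X : Type u) [AddCommGroup X] [Module A X] : Prop :=
  ∀ g : K →ₗ[A] X, ∃ h : A →ₗ[A] X, ∀ k : K, h k = g k

/-- Vanishing of `Ext¹(S, X)` in terms of a presentation `p : A → S`. -/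
lemma extendsFrom_ker_iff {S : Type u} [AddCommGroup S] [Module A S] {p : A →ₗ[A] S}
    (hp : Function.Surjective p) (X : Type u) [AddCommGroup X] [Module A X] :
    ExtendsFrom (LinearMap.ker p) X ↔
      Subsingleton (Ext (ModuleCat.of A S) (ModuleCat.of A X) 1) := by
  have hS := LinearMap.shortExact_shortComplexKer hp
  have hz (y : Ext (ModuleCat.of A A) (ModuleCat.of A X) 1) : y = 0 :=
    have : Projective (ModuleCat.of A A) :=
      (IsProjective.iff_projective (R := A) A).1 inferInstance
    Ext.eq_zero_of_projective (P := ModuleCat.of A A) y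
  constructor
  · intro h
    refine subsingleton_of_forall_eq 0 fun x => ?_
    obtain ⟨x₁, rfl⟩ := Ext.contravariant_sequence_exact₃ hS (ModuleCat.of A X) x (hz _)
      (n₀ := 0) rfl
    obtain ⟨g, rfl⟩ := Ext.homEquiv₀.symm.surjective x₁
    obtain ⟨e, he⟩ := h g.hom
    have : g = (LinearMap.shortComplexKer p).f ≫ ModuleCat.ofHom e := by
      ext k
      exact (he k).symm
    rw [this, Ext.homEquiv₀_symm_apply, ← Ext.mk₀_comp_mk₀, hS.extClass_comp_assoc]
  · intro h g
    obtain ⟨x₂, hx⟩ := Ext.contravariant_sequence_exact₁ hS (ModuleCat.of A X)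
      (Ext.mk₀ (ModuleCat.ofHom g)) (n₁ := 1) rfl (h.elim _ _)
    obtain ⟨e, rfl⟩ := Ext.homEquiv₀.symm.surjective x₂
    rw [Ext.homEquiv₀_symm_apply, Ext.mk₀_comp_mk₀] at hx
    have := Ext.homEquiv₀.symm.injective hx
    refine ⟨e.hom, fun k => ?_⟩
    exact LinearMap.congr_fun (congrArg ModuleCat.Hom.hom this) k

lemma projective_ker {S : Type u} [AddCommGroup S] [Module A S] {p : A →ₗ[A] S}
    (hp : Function.Surjective p) (h : HasProjectiveDimensionLE (ModuleCat.of A S) 1) :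
    Module.Projective A (LinearMap.ker p) := by
  have hS := LinearMap.shortExact_shortComplexKer hp
  have h2 : Projective (ModuleCat.of A A) :=
      (IsProjective.iff_projective (R := A) A).1 inferInstance
  have := (hS.hasProjectiveDimensionLT_X₃_iff 0 h2).1 h
  exact (IsProjective.iff_projective (R := A) (LinearMap.ker p)).2
    (projective_iff_hasProjectiveDimensionLT_one.2 this)

lemma ExtendsFrom.pi {K : Submodule A A} {X : Type u} [AddCommGroup X] [Module A X]
    (h : ExtendsFrom K X) (ι : Type) : ExtendsFrom K (ι → X) := by
  intro g
  choose e he using fun i => h (LinearMap.proj i ∘ₗ g)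
  exact ⟨LinearMap.pi e, fun k => funext fun i => he i k⟩

lemma ExtendsFrom.congr {K : Submodule A A} {X Y : Type u} [AddCommGroup X] [Module A X]
    [AddCommGroup Y] [Module A Y] (h : ExtendsFrom K X) (e : X ≃ₗ[A] Y) : ExtendsFrom K Y := by
  intro g
  obtain ⟨f, hf⟩ := h (e.symm.toLinearMap ∘ₗ g)
  exact ⟨e.toLinearMap ∘ₗ f, fun k => by simp [hf]⟩

/-- Over an artin algebra, homomorphisms between finitely generated modules are, up to the action
of central elements, generated by finitely many. -/
lemma exists_hom_generators (R : Type u) [CommRing R] [Algebra R A] [IsArtinianRing R]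
    [Module.Finite R A] (K X : Type u) [AddCommGroup K] [Module A K] [Module.Finite A K]
    [AddCommGroup X] [Module A X] [Module.Finite A X] :
    ∃ (m : ℕ) (f : Fin m → (K →ₗ[A] X)), ∀ g : K →ₗ[A] X,
      ∃ r : Fin m → R, ∀ k, g k = ∑ i, f i (algebraMap R A (r i) • k) := by
  let : Module R X := Module.compHom X (algebraMap R A)
  have : IsScalarTower R A X := ⟨fun r a x => by
    change (r • a) • x = algebraMap R A r • (a • x)
    rw [Algebra.smul_def, mul_smul]⟩
  have : SMulCommClass A R X := ⟨fun a r x => by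
    change a • (algebraMap R A r • x) = algebraMap R A r • (a • x)
    rw [← mul_smul, ← mul_smul, Algebra.commutes]⟩
  have : Module.Finite R X := Module.Finite.trans A X
  obtain ⟨n, s, hs⟩ := Module.Finite.exists_fin (R := A) (M := K)
  let ev : (K →ₗ[A] X) →ₗ[R] (Fin n → X) :=
    { toFun := fun g i => g (s i)
      map_add' := fun _ _ => rfl
      map_smul' := fun _ _ => rfl }
  have hev : Function.Injective ev := by
    intro g g' h
    refine LinearMap.ext_on_range hs fun i => congrFun h i
  have : IsNoetherian R (K →ₗ[A] X) := isNoetherian_of_injective ev hev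
  obtain ⟨m, f, hf⟩ := Module.Finite.exists_fin (R := R) (M := K →ₗ[A] X)
  refine ⟨m, f, fun g => ?_⟩
  obtain ⟨r, hr⟩ := (Submodule.mem_span_range_iff_exists_fun R).1 (hf ▸ Submodule.mem_top (x := g))
  refine ⟨r, fun k => ?_⟩
  rw [← hr, LinearMap.sum_apply]
  refine Finset.sum_congr rfl fun i _ => ?_
  rw [map_smul]
  rfl

/-- Existence of the universal map from a finitely generated module to one that is right
perpendicular to `S`. -/
lemma exists_reflection (R : Type u) [CommRing R] [Algebra R A] [IsArtinianRing R]
    [Module.Finite R A] {S : Type u} [AddCommGroup S] [Module A S] [IsSimpleModule A S]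
    {p : A →ₗ[A] S} (hp : Function.Surjective p) [Module.Projective A (LinearMap.ker p)]
    (hS : ExtendsFrom (LinearMap.ker p) S)
    (X : Type u) [AddCommGroup X] [Module A X] [Module.Finite A X] :
    ∃ (Y : Type u) (_ : AddCommGroup Y) (_ : Module A Y) (_ : Module.Finite A Y)
      (η : X →ₗ[A] Y), (∀ f : S →ₗ[A] Y, f = 0) ∧ ExtendsFrom (LinearMap.ker p) Y ∧
      ∀ (Z : Type u) [AddCommGroup Z] [Module A Z], (∀ f : S →ₗ[A] Z, f = 0) →
        ExtendsFrom (LinearMap.ker p) Z → ∀ f : X →ₗ[A] Z, ∃! g : Y →ₗ[A] Z, g ∘ₗ η = f := by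
  have : IsNoetherian R A := inferInstance
  have : IsNoetherianRing A := isNoetherian_of_tower R inferInstance
  obtain ⟨m, f, hf⟩ := exists_hom_generators (A := A) R (LinearMap.ker p) X
  -- `X'` is the extension of `S ^ m` by `X` with classes given by the `f i`
  let φ : (Fin m → LinearMap.ker p) →ₗ[A] X × (Fin m → A) :=
    (-(∑ i, f i ∘ₗ LinearMap.proj i)).prod
      (LinearMap.pi fun i => (LinearMap.ker p).subtype ∘ₗ LinearMap.proj i)
  let N := LinearMap.range φ
  let X' := (X × (Fin m → A)) ⧸ N
  let j : X →ₗ[A] X' := N.mkQ ∘ₗ LinearMap.inl A _ _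
  let c : (Fin m → A) →ₗ[A] X' := N.mkQ ∘ₗ LinearMap.inr A _ _
  have hjc (k : Fin m → LinearMap.ker p) : c (fun i => k i) = j (∑ i, f i (k i)) := by
    refine (Submodule.Quotient.eq N).2 ⟨k, ?_⟩
    refine Prod.ext ?_ (funext fun i => ?_) <;> simp [φ, -map_sum]
  -- homomorphisms from `K` to `X` extend after composition with `j`
  have hext1 (g : LinearMap.ker p →ₗ[A] X) : ∃ h : A →ₗ[A] X', ∀ k : LinearMap.ker p,
      h k = j (g k) := by
    obtain ⟨r, hr⟩ := hf g
    let q : A →ₗ[A] (Fin m → A) :=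
      LinearMap.pi fun i => LinearMap.toSpanSingleton A A (algebraMap R A (r i))
    refine ⟨c ∘ₗ q, fun k => ?_⟩
    rw [hr k, ← hjc fun i => algebraMap R A (r i) • k, LinearMap.comp_apply]
    congr 1
    funext i
    simp [q, Algebra.smul_def, Algebra.commutes]
  have hext : ExtendsFrom (LinearMap.ker p) X' := by
    intro g
    obtain ⟨g', hg'⟩ := Module.projective_lifting_property N.mkQ g N.mkQ_surjective
    obtain ⟨u, hu⟩ := hS.pi (Fin m)
      ((LinearMap.pi fun i => p ∘ₗ LinearMap.proj i) ∘ₗ LinearMap.snd A X (Fin m → A) ∘ₗ g')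
    choose a ha using fun i => hp (u 1 i)
    let v : A →ₗ[A] (Fin m → A) := LinearMap.toSpanSingleton A _ a
    have hv (b : A) (i : Fin m) : p (v b i) = u b i := by
      have : u b = b • u 1 := by rw [← map_smul]; simp
      simp only [v, LinearMap.toSpanSingleton_apply, Pi.smul_apply, map_smul, ha, this]
    let w : LinearMap.ker p →ₗ[A] (Fin m → LinearMap.ker p) := LinearMap.pi fun i =>
      LinearMap.codRestrict (LinearMap.ker p) (LinearMap.proj i ∘ₗ
        (LinearMap.snd A X (Fin m → A) ∘ₗ g' - v ∘ₗ (LinearMap.ker p).subtype)) (fun k => by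
          have h1 := congrFun (hu k) i
          have h2 := hv k i
          simp only [LinearMap.comp_apply, LinearMap.pi_apply, LinearMap.proj_apply] at h1
          simp [h2, h1])
    obtain ⟨h, hh⟩ := hext1 (LinearMap.fst A X (Fin m → A) ∘ₗ g' +
      (∑ i, f i ∘ₗ LinearMap.proj i) ∘ₗ w)
    refine ⟨h + c ∘ₗ v, fun k => ?_⟩
    have e1 : g k = N.mkQ (g' k) := (LinearMap.congr_fun hg' k).symm
    have e2 : g' k = LinearMap.inl A X (Fin m → A) (g' k).1 +
        (LinearMap.inr A X (Fin m → A) (fun i => (w k i : A)) +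
          LinearMap.inr A X (Fin m → A) (v k)) := by
      refine Prod.ext (by simp) (funext fun i => ?_)
      change (g' k).2 i = 0 + (((g' k).2 i - v k i) + v k i)
      simp
    rw [e1, e2, map_add, map_add]
    change h k + c (v k) = j (g' k).1 + (c (fun i => (w k i : A)) + c (v k))
    rw [hjc, hh, ← add_assoc, ← map_add]
    congr 2
    simp
  -- `Y` is the quotient of `X'` by its `S`-isotypic component
  let T := isotypicComponent A X' S
  have hT : ExtendsFrom (LinearMap.ker p) T := by
    obtain ⟨n, ⟨e⟩⟩ := (IsIsotypicOfType.isotypicComponent A X' S).linearEquiv_fun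
    exact (hS.pi (Fin n)).congr e.symm
  have hST (g : S →ₗ[A] X') (s : S) : g s ∈ T := by
    rcases g.injective_or_eq_zero with hg | rfl
    · exact (le_sSup ⟨(LinearEquiv.ofInjective g hg).symm⟩ :
        LinearMap.range g ≤ isotypicComponent A X' S) ⟨s, rfl⟩
    · simp
  have hdesc {Z : Type u} [AddCommGroup Z] [Module A Z] (d : A →ₗ[A] Z)
      (hd : ∀ k : LinearMap.ker p, d k = 0) : ∃ d' : S →ₗ[A] Z, ∀ a, d' (p a) = d a := by
    refine ⟨(LinearMap.ker p).liftQ d (fun k hk => hd ⟨k, hk⟩) ∘ₗ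
      (p.quotKerEquivOfSurjective hp).symm.toLinearMap, fun a => ?_⟩
    have : (p.quotKerEquivOfSurjective hp).symm (p a) = Submodule.Quotient.mk a := by
      rw [LinearEquiv.symm_apply_eq]; rfl
    rw [LinearMap.comp_apply, LinearEquiv.coe_coe, this]
    rfl
  refine ⟨X' ⧸ T, inferInstance, inferInstance, inferInstance, T.mkQ ∘ₗ j, ?_, ?_, ?_⟩
  · intro g
    obtain ⟨h, hh⟩ := Module.projective_lifting_property T.mkQ (g ∘ₗ p) T.mkQ_surjective
    have hh' (a : A) : T.mkQ (h a) = g (p a) := LinearMap.congr_fun hh a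
    obtain ⟨w, hw⟩ := hT (LinearMap.codRestrict T (h ∘ₗ (LinearMap.ker p).subtype) (fun k => by
      rw [← Submodule.Quotient.mk_eq_zero]
      have := hh' k
      rw [LinearMap.mem_ker.1 k.2, map_zero] at this
      exact this))
    obtain ⟨d, hd⟩ := hdesc (h - T.subtype ∘ₗ w) (fun k => by simp [hw])
    ext s
    obtain ⟨a, rfl⟩ := hp s
    rw [← hh', LinearMap.zero_apply]
    refine (Submodule.Quotient.mk_eq_zero T).2 ?_
    have h1 := hST d (p a)
    rw [hd] at h1
    have := T.add_mem h1 (w a).2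
    simpa using this
  · intro g
    obtain ⟨g', hg'⟩ := Module.projective_lifting_property T.mkQ g T.mkQ_surjective
    obtain ⟨h, hh⟩ := hext g'
    exact ⟨T.mkQ ∘ₗ h, fun k => by
      rw [LinearMap.comp_apply, hh, ← LinearMap.comp_apply, hg']⟩
  · intro Z _ _ hZ0 hZ1 g
    choose e he using fun i => hZ1 (g ∘ₗ f i)
    let g1 : X' →ₗ[A] Z := N.liftQ (g.coprod (∑ i, e i ∘ₗ LinearMap.proj i)) (by
      rintro _ ⟨k, rfl⟩
      simp [φ, he])
    let g2 : (X' ⧸ T) →ₗ[A] Z := T.liftQ g1 (sSup_le fun M ⟨eM⟩ x hx => by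
      have := LinearMap.congr_fun (hZ0 (g1 ∘ₗ M.subtype ∘ₗ eM.symm.toLinearMap)) (eM ⟨x, hx⟩)
      simpa using this)
    refine ⟨g2, ?_, fun g3 hg3 => ?_⟩
    · ext x
      change g x + _ = g x
      simp
    · have key : ∀ d : X' →ₗ[A] Z, d ∘ₗ j = 0 → d = 0 := by
        intro d hd
        refine Submodule.linearMap_qext _ (LinearMap.prod_ext hd ?_)
        refine LinearMap.pi_ext' fun i => ?_
        obtain ⟨d', hd'⟩ := hdesc (d ∘ₗ c ∘ₗ LinearMap.single A (fun _ => A) i) (fun k => by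
          have h1 := hjc (Pi.single i k)
          have h2 : (fun i' => ((Pi.single i k : Fin m → LinearMap.ker p) i' : A)) =
              Pi.single i (k : A) := by
            funext i'
            by_cases h : i' = i
            · subst h; simp
            · simp [h]
          rw [h2] at h1
          rw [LinearMap.comp_apply, LinearMap.comp_apply, LinearMap.coe_single, h1]
          exact LinearMap.congr_fun hd _)
        rw [hZ0 d'] at hd'
        ext
        exact (hd' 1).symm
      refine Submodule.linearMap_qext _ (sub_eq_zero.1 (key _ ?_))
      ext x
      have h3 := LinearMap.congr_fun hg3 x
      have h4 : g2 (T.mkQ (j x)) = g x := by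
        change g x + _ = g x
        simp
      simp only [LinearMap.comp_apply, LinearMap.sub_apply, LinearMap.zero_apply] at h3 ⊢
      rw [h3, h4, sub_self]

end Reflection

section Retraction

variable (A : Type u) [Ring A] [IsArtinAlgebra A]
  (S : Type u) [AddCommGroup S] [Module A S] [IsLocalizable A S]

lemma exists_perp_reflection (X : FGModuleCat.{u} A) :
    ∃ (Y : PerpCat A S) (η : X ⟶ (perpInclusion A S).obj Y), ∀ Z : PerpCat A S,
      Function.Bijective fun g : Y ⟶ Z => η ≫ (perpInclusion A S).map g := by
  obtain ⟨R, _, _, _, _⟩ := IsArtinAlgebra.exists_base (A := A)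
  have := IsLocalizable.isSimple (A := A) (S := S)
  have hpd : HasProjectiveDimensionLE (ModuleCat.of A S) 1 :=
    (projectiveDimension_le_iff _ 1).1 (IsLocalizable.projectiveDimension_le_one (A := A) (S := S))
  have := IsSimpleModule.nontrivial A S
  obtain ⟨s, hs⟩ := exists_ne (0 : S)
  have hp : Function.Surjective (LinearMap.toSpanSingleton A S s) :=
    IsSimpleModule.toSpanSingleton_surjective A hs
  have := projective_ker hp hpd
  obtain ⟨Y, _, _, _, η, h0, h1, hu⟩ := exists_reflection R hp
    ((extendsFrom_ker_iff hp S).2 IsLocalizable.subsingleton_ext_one) X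
  refine ⟨⟨FGModuleCat.of A Y, subsingleton_of_forall_eq 0 h0, (extendsFrom_ker_iff hp Y).1 h1⟩,
    ConcreteCategory.ofHom η, fun Z => ?_⟩
  have key := hu Z.obj (fun f => Z.property.1.elim f 0) ((extendsFrom_ker_iff hp Z.obj).2 Z.property.2)
  constructor
  · intro g g' h
    have h' := congrArg (fun f => f.hom.hom) h
    exact ObjectProperty.hom_ext _ (FGModuleCat.hom_ext ((key _).unique h' rfl))
  · intro f
    obtain ⟨g, hg, -⟩ := key f.hom.hom
    exact ⟨ObjectProperty.homMk (FGModuleCat.ofHom g), FGModuleCat.hom_ext hg⟩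

instance : (perpInclusion A S).IsRightAdjoint := by
  choose Y η h using exists_perp_reflection A S
  exact (Adjunction.adjunctionOfEquivLeft (F_obj := Y) (G := perpInclusion A S)
    (fun X Z => Equiv.ofBijective _ (h X Z)) (fun X Z Z' g f => by simp)).isRightAdjoint

/-- The left retraction of categories `i_λ : A-mod ⥤ S^⊥`, the left adjoint of the inclusion. -/
noncomputable def iLambda : FGModuleCat.{u} A ⥤ PerpCat A S :=
  (perpInclusion A S).leftAdjoint

/-- The adjoint pair `(i_λ, i)`. -/
noncomputable def perpAdj : iLambda A S ⊣ perpInclusion A S :=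
  Adjunction.ofIsRightAdjoint (perpInclusion A S)

/-- The localization functor `L = i i_λ`. -/
noncomputable abbrev perpL : FGModuleCat.{u} A ⥤ FGModuleCat.{u} A :=
  iLambda A S ⋙ perpInclusion A S

/-- The unit `η : Id ⟶ L` of the adjoint pair `(i_λ, i)`. -/
noncomputable abbrev perpUnit : 𝟭 (FGModuleCat.{u} A) ⟶ perpL A S :=
  (perpAdj A S).unit

/-- The underlying type of the algebra `L(A)`. -/
def RetractionAlgebra : Type u := (perpL A S).obj (FGModuleCat.of A A)

noncomputable instance : AddCommGroup (RetractionAlgebra A S) :=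
  inferInstanceAs (AddCommGroup ((perpL A S).obj (FGModuleCat.of A A)))

noncomputable instance : Module A (RetractionAlgebra A S) :=
  inferInstanceAs (Module A ((perpL A S).obj (FGModuleCat.of A A)))

/-- `η_A : A → L(A)` as an `A`-linear map. -/
noncomputable def etaLinear : A →ₗ[A] RetractionAlgebra A S :=
  ((perpUnit A S).app (FGModuleCat.of A A)).hom.hom

/-- For an element `y` of an `A`-module `Y`, the morphism `r_y : A → Y`, `a ↦ a • y`. -/
def rightMul (Y : FGModuleCat.{u} A) (y : Y) : FGModuleCat.of A A ⟶ Y :=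
  ConcreteCategory.ofHom (LinearMap.toSpanSingleton A Y y)

variable {A S}

/-- For `y` in an object `Y` of `S^⊥`, the unique extension `L(A) → Y` along `η_A` of the
morphism `r_y : A → Y`, `a ↦ a • y`. -/
noncomputable def extendRightMul (Y : PerpCat A S) (y : Y.obj) :
    RetractionAlgebra A S →ₗ[A] Y.obj :=
  (((perpAdj A S).homEquiv (FGModuleCat.of A A) Y).symm (rightMul A Y.obj y)).hom.hom.hom

lemma extendRightMul_eta (Y : PerpCat A S) (y : Y.obj) (a : A) :
    extendRightMul Y y (etaLinear A S a) = a • y := by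
  have h := ((perpAdj A S).homEquiv (FGModuleCat.of A A) Y).apply_symm_apply (rightMul A Y.obj y)
  rw [Adjunction.homEquiv_unit] at h
  exact LinearMap.congr_fun (congrArg (fun f => f.hom.hom) h) a

lemma retraction_hom_ext {Y : PerpCat A S} {f g : RetractionAlgebra A S →ₗ[A] Y.obj}
    (h : ∀ a, f (etaLinear A S a) = g (etaLinear A S a)) : f = g := by
  let f' : (iLambda A S).obj (FGModuleCat.of A A) ⟶ Y :=
    ObjectProperty.homMk (ObjectProperty.homMk (ModuleCat.ofHom f))
  let g' : (iLambda A S).obj (FGModuleCat.of A A) ⟶ Y :=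
    ObjectProperty.homMk (ObjectProperty.homMk (ModuleCat.ofHom g))
  have : f' = g' := by
    apply ((perpAdj A S).homEquiv (FGModuleCat.of A A) Y).injective
    rw [Adjunction.homEquiv_unit, Adjunction.homEquiv_unit]
    exact FGModuleCat.hom_ext (LinearMap.ext h)
  exact congrArg (fun f => f.hom.hom.hom) this

/-- The object `i_λ(A)` of `S^⊥`; its underlying `A`-module is `L(A)`. -/
noncomputable abbrev perpA (A S : Type u) [Ring A] [IsArtinAlgebra A] [AddCommGroup S] [Module A S]
    [IsLocalizable A S] : PerpCat A S := (iLambda A S).obj (FGModuleCat.of A A)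

/-- The unique extension `L(A) → L(A)` of `r_y : A → L(A)`, for `y` in `L(A)`. -/
noncomputable def starRight (y : RetractionAlgebra A S) :
    RetractionAlgebra A S →ₗ[A] RetractionAlgebra A S :=
  extendRightMul (perpA A S) y

lemma starRight_eta (y : RetractionAlgebra A S) (a : A) :
    starRight y (etaLinear A S a) = a • y :=
  extendRightMul_eta (perpA A S) y a

lemma retraction_end_ext {f g : RetractionAlgebra A S →ₗ[A] RetractionAlgebra A S}
    (h : ∀ a, f (etaLinear A S a) = g (etaLinear A S a)) : f = g :=
  retraction_hom_ext (Y := perpA A S) h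

/-- The multiplication of `L(A)`: `x ⋆ y` is the image of `x` under the unique extension
`L(A) → L(A)` of `r_y : A → L(A)`. -/
noncomputable instance : Mul (RetractionAlgebra A S) where
  mul x y := starRight y x

noncomputable instance : One (RetractionAlgebra A S) where
  one := etaLinear A S 1

lemma extendRightMul_add (Y : PerpCat A S) (y y' : Y.obj) :
    extendRightMul Y (y + y') = extendRightMul Y y + extendRightMul Y y' :=
  retraction_hom_ext fun a => by simp [extendRightMul_eta]

lemma extendRightMul_zero (Y : PerpCat A S) : extendRightMul Y (0 : Y.obj) = 0 :=
  retraction_hom_ext fun a => by simp [extendRightMul_eta]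

lemma extendRightMul_one (Y : PerpCat A S) (y : Y.obj) :
    extendRightMul Y y (1 : RetractionAlgebra A S) = y :=
  (extendRightMul_eta Y y 1).trans (one_smul A y)

lemma extendRightMul_mul (Y : PerpCat A S) (y : Y.obj) (x x' : RetractionAlgebra A S) :
    extendRightMul Y y (x * x') = extendRightMul Y (extendRightMul Y y x') x := by
  have : extendRightMul Y y ∘ₗ starRight x' = extendRightMul Y (extendRightMul Y y x') :=
    retraction_hom_ext fun a => by
      rw [LinearMap.comp_apply, starRight_eta, extendRightMul_eta, map_smul]
  exact LinearMap.congr_fun this x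

noncomputable instance : Ring (RetractionAlgebra A S) :=
  { (inferInstance : AddCommGroup (RetractionAlgebra A S)),
    (inferInstance : Mul (RetractionAlgebra A S)),
    (inferInstance : One (RetractionAlgebra A S)) with
    left_distrib := fun x y y' =>
      LinearMap.congr_fun (extendRightMul_add (perpA A S) y y') x
    right_distrib := fun x x' y => map_add (starRight y) x x'
    zero_mul := fun y => map_zero (starRight y)
    mul_zero := fun x => LinearMap.congr_fun (extendRightMul_zero (perpA A S)) x
    mul_assoc := fun x y z => (extendRightMul_mul (perpA A S) z x y)
    one_mul := fun y => extendRightMul_one (perpA A S) y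
    mul_one := fun x => by
      have : starRight (etaLinear A S 1) = LinearMap.id :=
        retraction_end_ext fun a => by
          rw [starRight_eta, LinearMap.id_apply, ← map_smul, smul_eq_mul, mul_one]
      exact LinearMap.congr_fun this x }

/-- In terms of the localization functor, `x ⋆ y = L(η_A)⁻¹ (L(r_y) x)`. -/
lemma retraction_mul_eq (x y : RetractionAlgebra A S) :
    (((perpL A S).map ((perpUnit A S).app (FGModuleCat.of A A))).hom.hom (x * y)) =
      ((perpL A S).map (rightMul A ((perpL A S).obj (FGModuleCat.of A A)) y)).hom.hom x := by
  let r : FGModuleCat.of A A ⟶ (perpInclusion A S).obj (perpA A S) := rightMul A _ y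
  have h2 : ((perpAdj A S).homEquiv (FGModuleCat.of A A) (perpA A S)).symm r ≫
      (iLambda A S).map ((perpUnit A S).app (FGModuleCat.of A A)) = (iLambda A S).map r := by
    rw [← cancel_mono ((perpAdj A S).counit.app ((iLambda A S).obj (FGModuleCat.of A A)))]
    rw [Category.assoc, (perpAdj A S).left_triangle_components, Category.comp_id,
      Adjunction.homEquiv_counit]
  exact LinearMap.congr_fun (congrArg (fun f => f.hom.hom.hom) h2) x

variable (A S)

/-- The left retraction `η_A : A → L(A)` of algebras. -/
noncomputable def leftRetraction : A →+* RetractionAlgebra A S :=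
  { (etaLinear A S).toAddMonoidHom with
    map_one' := rfl
    map_mul' := fun a b => by
      change etaLinear A S (a * b) = starRight (etaLinear A S b) (etaLinear A S a)
      rw [starRight_eta, ← map_smul, smul_eq_mul] }

variable {A S}

/-- The `L(A)`-module structure on an object `Y` of `S^⊥`: the action of `x` on `y` is the image
of `x` under the unique extension `L(A) → Y` of `r_y : A → Y`. -/
noncomputable instance (Y : PerpCat A S) : Module (RetractionAlgebra A S) Y.obj where
  smul x y := extendRightMul Y y x
  one_smul y := extendRightMul_one Y y
  mul_smul x x' y := extendRightMul_mul Y y x x'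
  smul_zero x := LinearMap.congr_fun (extendRightMul_zero Y) x
  smul_add x y y' := LinearMap.congr_fun (extendRightMul_add Y y y') x
  add_smul x x' y := map_add (extendRightMul Y y) x x'
  zero_smul y := map_zero (extendRightMul Y y)

/-- The `L(A)`-action extends the `A`-action along `η_A`. -/
lemma leftRetraction_smul (Y : PerpCat A S) (a : A) (y : Y.obj) :
    leftRetraction A S a • y = a • y :=
  extendRightMul_eta Y y a

variable (A S)

/-- The identification of `S^⊥` with `L(A)`-modules. -/
noncomputable def perpToModule : PerpCat A S ⥤ ModuleCat.{u} (RetractionAlgebra A S) where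
  obj Y := ModuleCat.of (RetractionAlgebra A S) Y.obj
  map {Y Z} f := ModuleCat.ofHom
    { toFun := f.hom.hom.hom
      map_add' := map_add f.hom.hom.hom
      map_smul' := fun x y => by
        have : f.hom.hom.hom ∘ₗ extendRightMul Y y = extendRightMul Z (f.hom.hom.hom y) :=
          retraction_hom_ext fun a => by
            rw [LinearMap.comp_apply, extendRightMul_eta, extendRightMul_eta, map_smul]
        exact LinearMap.congr_fun this x }

end Retraction

/-! Write `L` for the reflection onto `S^⊥`. Since `proj.dim S ≤ 1`, the modules perpendicular to
`S` are closed under cokernels (`IsPerp.of_exact`). The kernel and cokernel of `η_X` are powers of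
`S`. It follows that `L` is exact (`IsReflection.exact_map`, `IsReflection.injective_map`), and it
sends projectives to projectives.

This compares homological dimensions over `A` and `L(A)`. Exactness of `L` gives that `L` preserves
finite projective dimension (`IsReflection.finiteProjDim`) and that restriction along `η_A` leaves
injective dimension unchanged (`hasInjectiveDimensionLT_iff_retraction`). Because `A` and `L(A)`
differ only by copies of `S`, the module `L(A)` has finite projective dimension over `A`, so
restriction preserves finite projective dimension as well (`FiniteProjDim.of_retraction`). Finally
there is an exact sequence `0 → S → I → L(I) → 0` (`IsInjectiveEnvelope.exact_reflection`).

The right-hand Gorenstein condition is moved to the left by duality: the dual `W` of the regular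
module is an injective cogenerator, and the regular right module has finite injective dimension iff
`W` has finite projective dimension (`exists_injective_cogenerator`).

If `A` is Gorenstein, then `S` has finite injective dimension, hence so has `L(A)`; finitely
generated injectives have finite projective dimension over `A`, and applying `L` to `I` and to the
cogenerator `V` of `L(A)` gives the rest. Conversely, over the Gorenstein algebra `L(A)` finite
projective dimension of `L(I)` forces finite injective dimension, so `S`, and then `A`, has finite
injective dimension. Moreover `I` and `V` have finite projective dimension over `A`, and `W` is a
direct summand of some `V^n × I^m`. -/

/-! ### Finite projective and injective dimension. -/

section FiniteDimension

variable (A : Type u) [Ring A]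

/-- The module `M` has finite projective dimension. -/
def FiniteProjDim (M : Type u) [AddCommGroup M] [Module A M] : Prop :=
  projectiveDimension (ModuleCat.of A M) < ⊤

/-- The module `M` has finite injective dimension. -/
def FiniteInjDim (M : Type u) [AddCommGroup M] [Module A M] : Prop :=
  injectiveDimension (ModuleCat.of A M) < ⊤

variable {A} {M N P : Type u} [AddCommGroup M] [Module A M] [AddCommGroup N] [Module A N]
  [AddCommGroup P] [Module A P]

/-- The bound `n + 1` means dimension at most `n`, so that inductions on `n` start with projective
modules rather than with the zero module. -/
lemma finiteProjDim_iff :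
    FiniteProjDim A M ↔ ∃ n, HasProjectiveDimensionLT (ModuleCat.of A M) (n + 1) := by
  rw [FiniteProjDim, lt_top_iff_ne_top, projectiveDimension_ne_top_iff]

lemma finiteInjDim_iff :
    FiniteInjDim A M ↔ ∃ n, HasInjectiveDimensionLT (ModuleCat.of A M) (n + 1) := by
  rw [FiniteInjDim, lt_top_iff_ne_top, injectiveDimension_ne_top_iff]

lemma hasProjectiveDimensionLT_one_iff :
    HasProjectiveDimensionLT (ModuleCat.of A M) 1 ↔ Module.Projective A M := by
  rw [← projective_iff_hasProjectiveDimensionLT_one, IsProjective.iff_projective]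

lemma hasInjectiveDimensionLT_one_iff :
    HasInjectiveDimensionLT (ModuleCat.of A M) 1 ↔ Module.Injective A M := by
  rw [← injective_iff_hasInjectiveDimensionLT_one, Module.injective_iff_injective_object]

lemma FiniteProjDim.of_projective [Module.Projective A M] : FiniteProjDim A M :=
  finiteProjDim_iff.2 ⟨0, hasProjectiveDimensionLT_one_iff.2 inferInstance⟩

lemma FiniteInjDim.of_injective (h : Module.Injective A M) : FiniteInjDim A M :=
  finiteInjDim_iff.2 ⟨0, hasInjectiveDimensionLT_one_iff.2 h⟩

lemma exists_shortExact {f : M →ₗ[A] N} {g : N →ₗ[A] P} (hf : Function.Injective f)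
    (hfg : Function.Exact f g) (hg : Function.Surjective g) :
    ∃ h, (ShortComplex.mk (ModuleCat.ofHom f) (ModuleCat.ofHom g) h).ShortExact :=
  ⟨by ext x; exact hfg.apply_apply_eq_zero x, ModuleCat.shortComplex_shortExact _ hfg hf hg⟩

section Exact

variable {f : M →ₗ[A] N} {g : N →ₗ[A] P} (hf : Function.Injective f)
  (hfg : Function.Exact f g) (hg : Function.Surjective g)

include hf hfg hg

lemma FiniteProjDim.middle (h₁ : FiniteProjDim A M) (h₃ : FiniteProjDim A P) :
    FiniteProjDim A N := by
  obtain ⟨_, hS⟩ := exists_shortExact hf hfg hg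
  obtain ⟨m, hm⟩ := finiteProjDim_iff.1 h₁
  obtain ⟨n, hn⟩ := finiteProjDim_iff.1 h₃
  exact finiteProjDim_iff.2 ⟨m + n, hS.hasProjectiveDimensionLT_X₂ _
    (hasProjectiveDimensionLT_of_ge _ (m + 1) _ (by lia))
    (hasProjectiveDimensionLT_of_ge _ (n + 1) _ (by lia))⟩

lemma FiniteProjDim.right (h₁ : FiniteProjDim A M) (h₂ : FiniteProjDim A N) :
    FiniteProjDim A P := by
  obtain ⟨_, hS⟩ := exists_shortExact hf hfg hg
  obtain ⟨m, hm⟩ := finiteProjDim_iff.1 h₁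
  obtain ⟨n, hn⟩ := finiteProjDim_iff.1 h₂
  exact finiteProjDim_iff.2 ⟨m + n + 1, hS.hasProjectiveDimensionLT_X₃ _
    (hasProjectiveDimensionLT_of_ge _ (m + 1) _ (by lia))
    (hasProjectiveDimensionLT_of_ge _ (n + 1) _ (by lia))⟩

lemma FiniteInjDim.middle (h₁ : FiniteInjDim A M) (h₃ : FiniteInjDim A P) :
    FiniteInjDim A N := by
  obtain ⟨_, hS⟩ := exists_shortExact hf hfg hg
  obtain ⟨m, hm⟩ := finiteInjDim_iff.1 h₁
  obtain ⟨n, hn⟩ := finiteInjDim_iff.1 h₃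
  exact finiteInjDim_iff.2 ⟨m + n, hS.hasInjectiveDimensionLT_X₂ _
    (hasInjectiveDimensionLT_of_ge _ (m + 1) _ (by lia))
    (hasInjectiveDimensionLT_of_ge _ (n + 1) _ (by lia))⟩

lemma FiniteInjDim.right (h₁ : FiniteInjDim A M) (h₂ : FiniteInjDim A N) :
    FiniteInjDim A P := by
  obtain ⟨_, hS⟩ := exists_shortExact hf hfg hg
  obtain ⟨m, hm⟩ := finiteInjDim_iff.1 h₁
  obtain ⟨n, hn⟩ := finiteInjDim_iff.1 h₂
  exact finiteInjDim_iff.2 ⟨m + n, hS.hasInjectiveDimensionLT_X₃ _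
    (hasInjectiveDimensionLT_of_ge _ (n + 1) _ (by lia))
    (hasInjectiveDimensionLT_of_ge _ (m + 1) _ (by lia))⟩

lemma FiniteInjDim.left (h₂ : FiniteInjDim A N) (h₃ : FiniteInjDim A P) :
    FiniteInjDim A M := by
  obtain ⟨_, hS⟩ := exists_shortExact hf hfg hg
  obtain ⟨m, hm⟩ := finiteInjDim_iff.1 h₂
  obtain ⟨n, hn⟩ := finiteInjDim_iff.1 h₃
  exact finiteInjDim_iff.2 ⟨m + n + 1, hS.hasInjectiveDimensionLT_X₁ _
    (hasInjectiveDimensionLT_of_ge _ (n + 1) _ (by lia))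
    (hasInjectiveDimensionLT_of_ge _ (m + 1) _ (by lia))⟩

/-- The dimension shift along a short exact sequence with projective middle term. -/
lemma hasProjectiveDimensionLT_right_iff [Module.Projective A N] (n : ℕ) :
    HasProjectiveDimensionLT (ModuleCat.of A P) (n + 2) ↔
      HasProjectiveDimensionLT (ModuleCat.of A M) (n + 1) := by
  obtain ⟨_, hS⟩ := exists_shortExact hf hfg hg
  exact hS.hasProjectiveDimensionLT_X₃_iff n ((IsProjective.iff_projective N).1 inferInstance)

/-- The dimension shift along a short exact sequence with injective middle term. -/
lemma hasInjectiveDimensionLT_left_iff (hN : Module.Injective A N) (n : ℕ) :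
    HasInjectiveDimensionLT (ModuleCat.of A M) (n + 2) ↔
      HasInjectiveDimensionLT (ModuleCat.of A P) (n + 1) := by
  obtain ⟨_, hS⟩ := exists_shortExact hf hfg hg
  exact (hS.hasInjectiveDimensionLT_X₃_iff n
    ((Module.injective_iff_injective_object A N).1 hN)).symm

end Exact

lemma FiniteProjDim.of_retract (h : FiniteProjDim A N) (s : M →ₗ[A] N) (r : N →ₗ[A] M)
    (hrs : ∀ x, r (s x) = x) : FiniteProjDim A M := by
  have e : Retract (ModuleCat.of A M) (ModuleCat.of A N) :=
    ⟨ModuleCat.ofHom s, ModuleCat.ofHom r, by ext x; exact hrs x⟩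
  exact e.projectiveDimension_le.trans_lt h

lemma FiniteInjDim.of_retract (h : FiniteInjDim A N) (s : M →ₗ[A] N) (r : N →ₗ[A] M)
    (hrs : ∀ x, r (s x) = x) : FiniteInjDim A M := by
  have e : Retract (ModuleCat.of A M) (ModuleCat.of A N) :=
    ⟨ModuleCat.ofHom s, ModuleCat.ofHom r, by ext x; exact hrs x⟩
  exact e.injectiveDimension_le.trans_lt h

lemma FiniteProjDim.congr (h : FiniteProjDim A N) (e : M ≃ₗ[A] N) : FiniteProjDim A M :=
  h.of_retract e.toLinearMap e.symm.toLinearMap fun x => e.symm_apply_apply x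

lemma FiniteInjDim.congr (h : FiniteInjDim A N) (e : M ≃ₗ[A] N) : FiniteInjDim A M :=
  h.of_retract e.toLinearMap e.symm.toLinearMap fun x => e.symm_apply_apply x

lemma FiniteProjDim.prod (h₁ : FiniteProjDim A M) (h₂ : FiniteProjDim A N) :
    FiniteProjDim A (M × N) :=
  .middle LinearMap.inl_injective .inl_snd LinearMap.snd_surjective h₁ h₂

lemma FiniteInjDim.prod (h₁ : FiniteInjDim A M) (h₂ : FiniteInjDim A N) :
    FiniteInjDim A (M × N) :=
  .middle LinearMap.inl_injective .inl_snd LinearMap.snd_surjective h₁ h₂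

lemma FiniteProjDim.pi (h : FiniteProjDim A M) (n : ℕ) : FiniteProjDim A (Fin n → M) := by
  induction n with
  | zero => exact .of_projective
  | succ n ih => exact (h.prod ih).congr (Fin.consLinearEquiv A fun _ => M).symm

lemma FiniteInjDim.pi (h : FiniteInjDim A M) (n : ℕ) : FiniteInjDim A (Fin n → M) := by
  induction n with
  | zero => exact .of_injective ⟨fun X Y _ _ _ _ f _ g => ⟨0, fun x => Subsingleton.elim _ _⟩⟩
  | succ n ih => exact (h.prod ih).congr (Fin.consLinearEquiv A fun _ => M).symm

lemma Module.Injective.exists_retraction (h : Module.Injective A M) {f : M →ₗ[A] N}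
    (hf : Function.Injective f) : ∃ r : N →ₗ[A] M, ∀ x, r (f x) = x :=
  h.out f hf LinearMap.id

lemma Module.Injective.of_retract (h : Module.Injective A N) (s : M →ₗ[A] N) (r : N →ₗ[A] M)
    (hrs : ∀ x, r (s x) = x) : Module.Injective A M where
  out X Y _ _ _ _ f hf g := by
    obtain ⟨k, hk⟩ := h.out f hf (s ∘ₗ g)
    exact ⟨r ∘ₗ k, fun x => by simp [hk, hrs]⟩

/-- Induction on the projective dimension of finitely generated modules over a left noetherian
ring, along presentations by finite free modules. -/
lemma FiniteProjDim.induction [IsNoetherianRing A]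
    {motive : ∀ (M : Type u) [AddCommGroup M] [Module A M], Prop}
    (projective : ∀ (M : Type u) [AddCommGroup M] [Module A M] [Module.Finite A M]
      [Module.Projective A M], motive M)
    (step : ∀ (M : Type u) [AddCommGroup M] [Module A M] [Module.Finite A M] (n : ℕ)
      (π : (Fin n → A) →ₗ[A] M), Function.Surjective π → motive (LinearMap.ker π) → motive M)
    (M : Type u) [AddCommGroup M] [Module A M] [Module.Finite A M] (h : FiniteProjDim A M) :
    motive M := by
  obtain ⟨n, hn⟩ := finiteProjDim_iff.1 h
  clear h
  induction n generalizing M with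
  | zero =>
    have := hasProjectiveDimensionLT_one_iff.1 hn
    exact projective M
  | succ n ih =>
    obtain ⟨k, π, hπ⟩ := Module.Finite.exists_fin' A M
    refine step M k π hπ (ih _ ?_)
    exact (hasProjectiveDimensionLT_right_iff (LinearMap.ker π).subtype_injective
      (LinearMap.exact_subtype_ker_map π) hπ n).1 hn

/-- Finitely generated projectives are retracts of some `A^k`, and finite injective dimension passes
to the cokernel of `ker π → A^k`. -/
lemma FiniteInjDim.of_finiteProjDim [IsNoetherianRing A] (hA : FiniteInjDim A A)
    (M : Type u) [AddCommGroup M] [Module A M] [Module.Finite A M] (h : FiniteProjDim A M) :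
    FiniteInjDim A M := by
  refine FiniteProjDim.induction (motive := fun M _ _ => FiniteInjDim A M) ?_ ?_ M h
  · intro M _ _ _ _
    obtain ⟨k, π, hπ⟩ := Module.Finite.exists_fin' A M
    obtain ⟨s, hs⟩ := Module.projective_lifting_property π LinearMap.id hπ
    exact (hA.pi k).of_retract s π (LinearMap.congr_fun hs)
  · intro M _ _ _ k π hπ hK
    exact hK.right (LinearMap.ker π).subtype_injective (LinearMap.exact_subtype_ker_map π) hπ
      (hA.pi k)

end FiniteDimension

/-! ### Existence of injective envelopes. -/

section InjectiveEnvelope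

variable {A : Type u} [Ring A]

lemma exists_injective_embedding (M : Type u) [AddCommGroup M] [Module A M] :
    ∃ (J : Type u) (_ : AddCommGroup J) (_ : Module A J) (f : M →ₗ[A] J),
      Module.Injective A J ∧ Function.Injective f := by
  obtain ⟨⟨J, hJ, f, hf⟩⟩ := EnoughInjectives.presentation (ModuleCat.of A M)
  exact ⟨J, inferInstance, inferInstance, f.hom,
    (Module.injective_iff_injective_object A J).2 hJ, (ModuleCat.mono_iff_injective f).1 hf⟩

/-- Zorn's lemma for submodules defined by a condition on elements. -/
lemma exists_le_maximal_submodule {M : Type u} [AddCommGroup M] [Module A M] {p : M → Prop}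
    (N : Submodule A M) (hN : ∀ x ∈ N, p x) :
    ∃ E : Submodule A M, N ≤ E ∧ Maximal (fun E : Submodule A M => ∀ x ∈ E, p x) E := by
  refine zorn_le_nonempty₀ {E : Submodule A M | ∀ x ∈ E, p x} (fun c hc hchain E hE => ?_) N hN
  refine ⟨sSup c, fun x hx => ?_, fun z hz => le_sSup hz⟩
  obtain ⟨F, hF, hxF⟩ := (Submodule.mem_sSup_of_directed ⟨E, hE⟩ hchain.directedOn).1 hx
  exact hc hF x hxF

/-- Inside an injective module, a maximal essential extension of `M` is a direct summand, with
complement a maximal submodule meeting it trivially. -/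
lemma exists_isInjectiveEnvelope (M : Type u) [AddCommGroup M] [Module A M] :
    ∃ (E : Type u) (_ : AddCommGroup E) (_ : Module A E) (ι : M →ₗ[A] E),
      IsInjectiveEnvelope ι := by
  obtain ⟨J, _, _, f, hJ, hf⟩ := exists_injective_embedding (A := A) M
  -- a maximal essential extension `E` of `M` in `J`
  let p : J → Prop := fun x => x ≠ 0 → ∃ a : A, a • x ∈ LinearMap.range f ∧ a • x ≠ 0
  obtain ⟨E, hfE, hE⟩ := exists_le_maximal_submodule (p := p) (LinearMap.range f)
    fun x hx h0 => ⟨1, by simpa using hx, by simpa using h0⟩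
  -- a maximal submodule `C` of `J` meeting `E` trivially
  obtain ⟨C, -, hC⟩ := exists_le_maximal_submodule (p := fun x => x ∈ E → x = 0)
    (⊥ : Submodule A J) fun x hx _ => (Submodule.mem_bot A).1 hx
  obtain ⟨g, hg⟩ := hJ.out (C.mkQ ∘ₗ E.subtype) (by
    rw [← LinearMap.ker_eq_bot, LinearMap.ker_eq_bot']
    intro x hx
    exact Subtype.ext (hC.1 x ((Submodule.Quotient.mk_eq_zero C).1 hx) x.2)) E.subtype
  have hgE (x : J) (hx : x ∈ E) : g (C.mkQ x) = x := hg ⟨x, hx⟩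
  have hEg : E ≤ LinearMap.range g := fun x hx => ⟨C.mkQ x, hgE x hx⟩
  -- The range of `g` is still essential over `M`. If `g (C.mkQ x) ≠ 0` then `x ∉ C`, so by
  -- maximality of `C` some nonzero `c + a • x` with `c ∈ C` lies in `E`, and it equals `a • g
  -- (C.mkQ x)`. Maximality of `E` then makes `g ∘ C.mkQ` a retraction onto `E`.
  have hgp : ∀ x ∈ LinearMap.range g, p x := by
    rintro _ ⟨y, rfl⟩ h0
    obtain ⟨x, rfl⟩ := C.mkQ_surjective y
    have hx : ¬ C ⊔ Submodule.span A {x} ≤ C := fun h => h0 (by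
      have hxC : x ∈ C := h (Submodule.mem_sup_right (Submodule.mem_span_singleton_self x))
      rw [Submodule.mkQ_apply, (Submodule.Quotient.mk_eq_zero C).2 hxC, map_zero])
    have hx' : ¬ ∀ z ∈ C ⊔ Submodule.span A {x}, z ∈ E → z = 0 := fun h =>
      hx (hC.2 h le_sup_left)
    push Not at hx'
    obtain ⟨z, hz, hzE, hz0⟩ := hx'
    obtain ⟨c, hc, w, hw, rfl⟩ := Submodule.mem_sup.1 hz
    obtain ⟨a, rfl⟩ := Submodule.mem_span_singleton.1 hw
    have e : a • g (C.mkQ x) = c + a • x := by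
      rw [← hgE _ hzE, map_add, Submodule.mkQ_apply C c, (Submodule.Quotient.mk_eq_zero C).2 hc,
        zero_add, map_smul, map_smul]
    obtain ⟨b, hb, hb0⟩ := hE.1 _ hzE hz0
    exact ⟨b * a, by rwa [mul_smul, e], by rwa [mul_smul, e]⟩
  have hgE' : LinearMap.range g ≤ E := hE.2 hgp hEg
  refine ⟨E, inferInstance, inferInstance, f.codRestrict E fun x => hfE ⟨x, rfl⟩, ?_, ?_, ?_⟩
  · exact hJ.of_retract E.subtype
      ((g ∘ₗ C.mkQ).codRestrict E fun x => hgE' ⟨_, rfl⟩) fun x => Subtype.ext (hg x)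
  · exact fun x y h => hf (congrArg Subtype.val h)
  · intro N hN
    rw [Submodule.eq_bot_iff]
    intro x hx
    by_contra h0
    obtain ⟨a, ⟨m, hm⟩, ha0⟩ := hE.1 x x.2 fun h => h0 (Subtype.ext h)
    have : a • x ∈ N ⊓ LinearMap.range (f.codRestrict E fun x => hfE ⟨x, rfl⟩) :=
      ⟨N.smul_mem a hx, m, Subtype.ext hm⟩
    rw [hN, Submodule.mem_bot] at this
    exact ha0 (congrArg Subtype.val this)

/-- Homomorphisms from a simple module to the injective envelope of `M` have values in `M`. -/
lemma IsInjectiveEnvelope.apply_mem_range {M I : Type u} [AddCommGroup M] [Module A M]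
    [AddCommGroup I] [Module A I] {ι : M →ₗ[A] I} (hι : IsInjectiveEnvelope ι)
    {S : Type u} [AddCommGroup S] [Module A S] [IsSimpleModule A S] (g : S →ₗ[A] I) (s : S) :
    g s ∈ LinearMap.range ι := by
  rcases eq_bot_or_eq_top (Submodule.comap g (LinearMap.range ι)) with h | h
  · have : LinearMap.range g = ⊥ := hι.essential _ (by
      rw [Submodule.eq_bot_iff]
      rintro _ ⟨⟨t, rfl⟩, ht⟩
      have : t ∈ Submodule.comap g (LinearMap.range ι) := ht
      rw [h, Submodule.mem_bot] at this
      rw [this, map_zero])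
    have h0 : g s ∈ LinearMap.range g := ⟨s, rfl⟩
    rw [this, Submodule.mem_bot] at h0
    rw [h0]
    exact zero_mem _
  · have : s ∈ Submodule.comap g (LinearMap.range ι) := h ▸ Submodule.mem_top
    exact this

end InjectiveEnvelope

/-! ### Matlis duality over a commutative artinian ring. -/

section MatlisDuality

variable (R : Type u) [CommRing R]

/-- The product of the residue fields. -/
abbrev ResidueProduct : Type u := ∀ m : MaximalSpectrum R, R ⧸ m.asIdeal

variable {R}

/-- An element killed by `m` is supported at the coordinate `m`, since any other maximal ideal
misses some element of `m`. There it lives in the field `R ⧸ m`. -/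
lemma residueProduct_exists_smul_eq {m : Ideal R} [hm : m.IsMaximal] {x y : ResidueProduct R}
    (hx : ∀ r ∈ m, r • x = 0) (hy : ∀ r ∈ m, r • y = 0) (h0 : x ≠ 0) : ∃ r : R, r • x = y := by
  have key {z : ResidueProduct R} (hz : ∀ r ∈ m, r • z = 0) (n : MaximalSpectrum R)
      (hn : n ≠ ⟨m, hm⟩) : z n = 0 := by
    have : ¬ m ≤ n.asIdeal := fun h =>
      hn (MaximalSpectrum.ext (hm.eq_of_le n.isMaximal.ne_top h).symm)
    obtain ⟨r, hr, hrn⟩ := SetLike.not_le_iff_exists.1 this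
    have h1 : Ideal.Quotient.mk n.asIdeal r * z n = 0 := congrFun (hz r hr) n
    have := n.isMaximal.isPrime
    exact (mul_eq_zero.1 h1).resolve_left fun h => hrn (Ideal.Quotient.eq_zero_iff_mem.1 h)
  have hxm : x ⟨m, hm⟩ ≠ 0 := fun h => h0 (funext fun n => by
    by_cases hn : n = ⟨m, hm⟩
    · rw [hn]; exact h
    · exact key hx n hn)
  obtain ⟨a, ha⟩ := Ideal.Quotient.mk_surjective (x ⟨m, hm⟩)
  obtain ⟨b, hb⟩ := Ideal.Quotient.mk_surjective (y ⟨m, hm⟩)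
  obtain ⟨c, i, hi, hci⟩ := hm.exists_inv (x := a) fun h =>
    hxm (ha ▸ Ideal.Quotient.eq_zero_iff_mem.2 h)
  refine ⟨b * c, funext fun n => ?_⟩
  by_cases hn : n = ⟨m, hm⟩
  · subst hn
    rw [Pi.smul_apply, ← ha, ← hb]
    refine Ideal.Quotient.eq.2 ?_
    have : b * c * a - b = -(b * i) := by linear_combination b * hci
    exact this ▸ neg_mem (Ideal.mul_mem_left _ b hi)
  · rw [Pi.smul_apply, key hx n hn, key hy n hn, smul_zero]

/-- A dualizing module for finitely generated modules over a commutative artinian ring. -/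
structure IsMatlisModule (R : Type u) [CommRing R] (E : Type u) [AddCommGroup E] [Module R E] :
    Prop where
  injective : Module.Injective R E
  exists_ne_zero : ∀ (M : Type u) [AddCommGroup M] [Module R M] (x : M), x ≠ 0 →
    ∃ f : M →ₗ[R] E, f x ≠ 0
  finite_hom : ∀ (M : Type u) [AddCommGroup M] [Module R M] [Module.Finite R M],
    Module.Finite R (M →ₗ[R] E)
  exists_eval : ∀ (M : Type u) [AddCommGroup M] [Module R M] [Module.Finite R M]
    (φ : (M →ₗ[R] E) →ₗ[R] E), ∃ x : M, ∀ f, φ f = f x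

variable {E : Type u} [AddCommGroup E] [Module R E]

/-- A homomorphism from `T` lands in the product of the residue fields and is determined by its
value at a generator `t`. That value is killed by the maximal annihilator of `t`, so any nonzero
homomorphism generates all of them. -/
lemma IsInjectiveEnvelope.length_hom_le_one {ι : ResidueProduct R →ₗ[R] E}
    (hι : IsInjectiveEnvelope ι) (T : Type u) [AddCommGroup T] [Module R T] [IsSimpleModule R T] :
    Module.length R (T →ₗ[R] E) ≤ 1 := by
  rcases subsingleton_or_nontrivial (T →ₗ[R] E) with h | h
  · rw [Module.length_eq_zero]; exact zero_le_one
  refine (Module.length_eq_one_iff.2 ?_).le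
  rw [isSimpleModule_iff_toSpanSingleton_surjective]
  refine ⟨h, fun f hf g => ?_⟩
  have := IsSimpleModule.nontrivial R T
  obtain ⟨t, ht⟩ := exists_ne (0 : T)
  have hsurj := IsSimpleModule.toSpanSingleton_surjective R ht
  have hmax : Ideal.IsMaximal (LinearMap.ker (LinearMap.toSpanSingleton R T t)) :=
    IsSimpleModule.ker_toSpanSingleton_isMaximal R ht
  obtain ⟨x, hx⟩ := hι.apply_mem_range f t
  obtain ⟨y, hy⟩ := hι.apply_mem_range g t
  have ann {k : T →ₗ[R] E} {z : ResidueProduct R} (hz : ι z = k t) (r : R)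
      (hr : r ∈ LinearMap.ker (LinearMap.toSpanSingleton R T t)) : r • z = 0 :=
    hι.injective (by
      rw [map_smul, hz, map_zero, ← map_smul]
      rw [LinearMap.mem_ker, LinearMap.toSpanSingleton_apply] at hr
      rw [hr, map_zero])
  obtain ⟨r, hr⟩ := residueProduct_exists_smul_eq (m :=
    LinearMap.ker (LinearMap.toSpanSingleton R T t)) (ann hx) (ann hy) (fun h0 => hf (by
      ext s
      obtain ⟨a, rfl⟩ := hsurj s
      rw [LinearMap.toSpanSingleton_apply, map_smul, ← hx, h0, map_zero, smul_zero,
        LinearMap.zero_apply]))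
  refine ⟨r, LinearMap.ext fun s => ?_⟩
  obtain ⟨a, rfl⟩ := hsurj s
  rw [LinearMap.toSpanSingleton_apply, LinearMap.toSpanSingleton_apply, map_smul, map_smul, ← hy,
    ← hr, map_smul, hx, LinearMap.smul_apply]

/-- `Hom(-, E)` is exact, so the bound for simple modules adds up along a composition series. -/
lemma length_hom_le (hE : Module.Injective R E)
    (h1 : ∀ (T : Type u) [AddCommGroup T] [Module R T] [IsSimpleModule R T],
      Module.length R (T →ₗ[R] E) ≤ 1)
    (M : Type u) [AddCommGroup M] [Module R M] (hM : IsFiniteLength R M) :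
    Module.length R (M →ₗ[R] E) ≤ Module.length R M := by
  induction hM with
  | of_subsingleton => rw [Module.length_eq_zero]; exact bot_le
  | @of_simple_quotient M _ _ N _ hN ih =>
    have hexact : Function.Exact (LinearMap.lcomp R E N.mkQ) (LinearMap.lcomp R E N.subtype) := by
      intro g
      constructor
      · intro h
        have hg : N ≤ LinearMap.ker g := fun x hx => LinearMap.congr_fun h ⟨x, hx⟩
        exact ⟨N.liftQ g hg, N.liftQ_mkQ g hg⟩
      · rintro ⟨f, rfl⟩
        ext x
        change f (N.mkQ x) = 0
        rw [Submodule.mkQ_apply, (Submodule.Quotient.mk_eq_zero N).2 x.2, map_zero]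
    rw [Module.length_eq_add_of_exact (LinearMap.lcomp R E N.mkQ) (LinearMap.lcomp R E N.subtype)
      (fun f g h => Submodule.linearMap_qext N h)
      (fun g => (hE.out N.subtype N.subtype_injective g).imp fun h hh => LinearMap.ext hh) hexact,
      Module.length_eq_add_of_exact N.subtype N.mkQ N.subtype_injective N.mkQ_surjective
        (LinearMap.exact_subtype_mkQ N), add_comm]
    refine add_le_add ih ?_
    rw [Module.length_eq_one R (M ⧸ N)]
    exact h1 _

lemma finite_of_length_le {M N : Type u} [AddCommGroup M] [Module R M] [AddCommGroup N]
    [Module R N] (hM : IsFiniteLength R M) (h : Module.length R N ≤ Module.length R M) :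
    IsFiniteLength R N :=
  Module.length_ne_top_iff.1 (ne_top_of_le_ne_top (Module.length_ne_top_iff.2 hM) h)

/-- The injective envelope of the product of the residue fields works. It cogenerates because every
nonzero cyclic module surjects onto some `R ⧸ m`. Dualizing does not increase length, so the
injective evaluation map from `M` to its double dual must be onto. -/
lemma exists_isMatlisModule (R : Type u) [CommRing R] [IsArtinianRing R] :
    ∃ (E : Type u) (_ : AddCommGroup E) (_ : Module R E), IsMatlisModule R E := by
  obtain ⟨E, _, _, ι, hι⟩ := exists_isInjectiveEnvelope (A := R) (ResidueProduct R)
  have fl (M : Type u) [AddCommGroup M] [Module R M] [Module.Finite R M] : IsFiniteLength R M :=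
    isFiniteLength_iff_isNoetherian_isArtinian.2 ⟨inferInstance, inferInstance⟩
  have hlen (M : Type u) [AddCommGroup M] [Module R M] [Module.Finite R M] :
      Module.length R (M →ₗ[R] E) ≤ Module.length R M :=
    length_hom_le hι.moduleInjective (fun T _ _ _ => hι.length_hom_le_one T) M (fl M)
  have fin (M : Type u) [AddCommGroup M] [Module R M] [Module.Finite R M] :
      Module.Finite R (M →ₗ[R] E) :=
    have := (isFiniteLength_iff_isNoetherian_isArtinian.1 (finite_of_length_le (fl M) (hlen M))).1
    inferInstance
  have cogen (M : Type u) [AddCommGroup M] [Module R M] (x : M) (hx : x ≠ 0) :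
      ∃ f : M →ₗ[R] E, f x ≠ 0 := by
    classical
    let t := LinearMap.toSpanSingleton R M x
    obtain ⟨m, hm, htm⟩ := Ideal.exists_le_maximal (LinearMap.ker t) (fun h => hx (by
      have : (1 : R) ∈ LinearMap.ker t := h ▸ Submodule.mem_top
      simpa [t] using this))
    let φ : R →ₗ[R] E := ι ∘ₗ LinearMap.single R (fun n : MaximalSpectrum R => R ⧸ n.asIdeal)
      ⟨m, hm⟩ ∘ₗ Submodule.mkQ m
    obtain ⟨h, hh⟩ := hι.moduleInjective.out ((LinearMap.ker t).liftQ t le_rfl)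
      (by rw [← LinearMap.ker_eq_bot]; exact Submodule.ker_liftQ_eq_bot' _ _ rfl)
      ((LinearMap.ker t).liftQ φ fun r hr => by
        have : Submodule.mkQ m r = 0 := (Submodule.Quotient.mk_eq_zero m).2 (htm hr)
        simp only [φ, LinearMap.mem_ker, LinearMap.comp_apply, this, map_zero])
    refine ⟨h, fun h0 => ?_⟩
    have h1 : h x = φ 1 := by
      have := hh (Submodule.Quotient.mk 1)
      rwa [Submodule.liftQ_apply, Submodule.liftQ_apply, LinearMap.toSpanSingleton_apply,
        one_smul] at this
    rw [h0] at h1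
    have h2 := congrFun (hι.injective ((map_zero ι).trans h1)) ⟨m, hm⟩
    simp only [LinearMap.comp_apply, LinearMap.single_apply, Pi.single_eq_same,
      Pi.zero_apply] at h2
    exact hm.ne_top ((Ideal.eq_top_iff_one m).2 ((Submodule.Quotient.mk_eq_zero m).1 h2.symm))
  refine ⟨E, inferInstance, inferInstance, hι.moduleInjective, cogen, fin, ?_⟩
  · intro M _ _ _ φ
    let ev : M →ₗ[R] ((M →ₗ[R] E) →ₗ[R] E) := LinearMap.flip LinearMap.id
    have hev : Function.Injective ev := by
      rw [injective_iff_map_eq_zero]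
      intro x hx
      by_contra h0
      obtain ⟨f, hf⟩ := cogen M x h0
      exact hf (LinearMap.congr_fun hx f)
    have := fin M
    have := fin (M →ₗ[R] E)
    have hsurj : LinearMap.range ev = ⊤ := by
      by_contra hne
      have h1 := Submodule.length_lt hne
      rw [← (LinearEquiv.ofInjective ev hev).length_eq] at h1
      exact absurd ((hlen _).trans (hlen M)) (not_le_of_gt h1)
    obtain ⟨x, hx⟩ := LinearMap.range_eq_top.1 hsurj φ
    exact ⟨x, fun f => by rw [← hx]; rfl⟩

end MatlisDuality

/-- Among maps to powers of `W`, take one with minimal kernel; a further coordinate not vanishing at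
a kernel element would make the kernel smaller. -/
lemma exists_embedding_pi {A M : Type u} [Ring A] [AddCommGroup M] [Module A M] [IsArtinian A M] {W : Type u} [AddCommGroup W] [Module A W]
    (h : ∀ x : M, x ≠ 0 → ∃ f : M →ₗ[A] W, f x ≠ 0) :
    ∃ (n : ℕ) (f : M →ₗ[A] (Fin n → W)), Function.Injective f := by
  obtain ⟨_, ⟨n, f, rfl⟩, hf⟩ := IsArtinian.set_has_minimal
    {N : Submodule A M | ∃ (n : ℕ) (f : M →ₗ[A] (Fin n → W)), LinearMap.ker f = N}
    ⟨_, 0, 0, rfl⟩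
  refine ⟨n, f, (injective_iff_map_eq_zero f).2 fun x hx => ?_⟩
  by_contra h0
  obtain ⟨g, hg⟩ := h x h0
  refine hf _ ⟨n + 1, LinearMap.pi (Fin.cons g fun i => LinearMap.proj i ∘ₗ f), rfl⟩
    (lt_of_le_not_ge (fun y hy => ?_) fun hle => hg ?_)
  · rw [LinearMap.mem_ker] at hy ⊢
    funext i
    exact congrFun hy i.succ
  · exact congrFun (LinearMap.mem_ker.1 (hle hx)) 0

/-- A homomorphism factors through a surjection whose kernel it annihilates. -/
lemma exists_descend {A : Type u} [Ring A] {M N Z : Type u} [AddCommGroup M] [Module A M] [AddCommGroup N] [Module A N]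
    [AddCommGroup Z] [Module A Z] {p : M →ₗ[A] N} (hp : Function.Surjective p) (d : M →ₗ[A] Z)
    (hd : LinearMap.ker p ≤ LinearMap.ker d) : ∃ d' : N →ₗ[A] Z, ∀ a, d' (p a) = d a := by
  refine ⟨(LinearMap.ker p).liftQ d hd ∘ₗ
    (p.quotKerEquivOfSurjective hp).symm.toLinearMap, fun a => ?_⟩
  have : (p.quotKerEquivOfSurjective hp).symm (p a) = Submodule.Quotient.mk a := by
    rw [LinearEquiv.symm_apply_eq]; rfl
  rw [LinearMap.comp_apply, LinearEquiv.coe_coe, this]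
  rfl

/-! ### Duality between left and right modules over an artin algebra. -/

section ArtinDuality

open MulOpposite

variable {R A E : Type u} [CommRing R] [Ring A] [Algebra R A] [AddCommGroup E] [Module R E]

/-- The left `A`-module structure on `Hom_R(A, E)`. -/
@[reducible] def regularDualModule (R A E : Type u) [CommRing R] [Ring A] [Algebra R A]
    [AddCommGroup E] [Module R E] : Module A (A →ₗ[R] E) where
  smul a f := f ∘ₗ LinearMap.mulRight R a
  one_smul f := LinearMap.ext fun x => congrArg f (mul_one x)
  mul_smul a b f := LinearMap.ext fun x => congrArg f (mul_assoc x a b).symm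
  smul_zero a := LinearMap.ext fun _ => rfl
  smul_add a f g := LinearMap.ext fun _ => rfl
  add_smul a b f := LinearMap.ext fun x => by
    change f (x * (a + b)) = f (x * a) + f (x * b)
    rw [mul_add, map_add]
  zero_smul f := LinearMap.ext fun x => by
    change f (x * 0) = 0
    rw [mul_zero, map_zero]

/-- The right `A`-module structure on the dual `Hom_R(M, E)` of a left `A`-module `M`. -/
@[reducible] def dualModule (R A E M : Type u) [CommRing R] [Ring A] [Algebra R A]
    [AddCommGroup E] [Module R E] [AddCommGroup M] [Module A M] [Module R M]
    [IsScalarTower R A M] : Module Aᵐᵒᵖ (M →ₗ[R] E) where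
  smul a f := f ∘ₗ Algebra.lsmul R R M a.unop
  one_smul f := LinearMap.ext fun x => congrArg f (one_smul A x)
  mul_smul a b f := LinearMap.ext fun x => congrArg f (mul_smul b.unop a.unop x)
  smul_zero a := LinearMap.ext fun _ => rfl
  smul_add a f g := LinearMap.ext fun _ => rfl
  add_smul a b f := LinearMap.ext fun x => by
    change f ((a.unop + b.unop) • x) = f (a.unop • x) + f (b.unop • x)
    rw [add_smul, map_add]
  zero_smul f := LinearMap.ext fun x => by
    change f ((0 : A) • x) = 0
    rw [zero_smul, map_zero]

attribute [local instance] regularDualModule dualModule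

lemma regularDual_smul_apply (a : A) (f : A →ₗ[R] E) (x : A) : (a • f) x = f (x * a) := rfl

section

variable {M N : Type u} [AddCommGroup M] [Module A M] [Module R M] [IsScalarTower R A M]
  [AddCommGroup N] [Module A N] [Module R N] [IsScalarTower R A N]

lemma dual_smul_apply (a : Aᵐᵒᵖ) (f : M →ₗ[R] E) (x : M) : (a • f) x = f (a.unop • x) := rfl

/-- The transpose of an `A`-linear map. -/
def dualTranspose (R E : Type u) [CommRing R] [Algebra R A] [AddCommGroup E] [Module R E]
    [Module R M] [IsScalarTower R A M] [Module R N] [IsScalarTower R A N]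
    (φ : M →ₗ[A] N) : (N →ₗ[R] E) →ₗ[Aᵐᵒᵖ] (M →ₗ[R] E) where
  toFun f := f ∘ₗ φ.restrictScalars R
  map_add' _ _ := rfl
  map_smul' a f := LinearMap.ext fun x => congrArg f (map_smul φ a.unop x).symm

end

/-- Coinduction: evaluation at `1` identifies `A`-linear maps `K → Hom_R(A, E)` with `R`-linear maps
`K → E`, and those extend. -/
lemma regularDual_injective (hE : Module.Injective R E) : Module.Injective A (A →ₗ[R] E) := by
  refine Module.Baer.injective fun K g => ?_
  let g₁ : K →ₗ[R] E :=
    { toFun := fun k => g k 1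
      map_add' := fun x y => by rw [map_add]; rfl
      map_smul' := fun r k => by
        have h1 : r • k = algebraMap R A r • k := (algebraMap_smul A r k).symm
        rw [h1, map_smul, regularDual_smul_apply, one_mul, Algebra.algebraMap_eq_smul_one,
          map_smul]
        rfl }
  obtain ⟨h, hh⟩ := hE.out (K.subtype.restrictScalars R) K.subtype_injective g₁
  refine ⟨LinearMap.toSpanSingleton A _ h, fun x hx => LinearMap.ext fun a => ?_⟩
  have h2 := hh (a • ⟨x, hx⟩)
  change h (a * x) = g (a • ⟨x, hx⟩) 1 at h2
  rw [LinearMap.toSpanSingleton_apply, regularDual_smul_apply, h2, map_smul,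
    regularDual_smul_apply, one_mul]

lemma dual_self_injective (hE : Module.Injective R E) : Module.Injective Aᵐᵒᵖ (A →ₗ[R] E) := by
  have h := regularDual_injective (A := Aᵐᵒᵖ) hE
  let s : (A →ₗ[R] E) →ₗ[Aᵐᵒᵖ] (Aᵐᵒᵖ →ₗ[R] E) :=
    { toFun := fun f => f ∘ₗ (opLinearEquiv R).symm.toLinearMap
      map_add' := fun _ _ => rfl
      map_smul' := fun _ _ => rfl }
  let r : (Aᵐᵒᵖ →ₗ[R] E) →ₗ[Aᵐᵒᵖ] (A →ₗ[R] E) :=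
    { toFun := fun f => f ∘ₗ (opLinearEquiv R).toLinearMap
      map_add' := fun _ _ => rfl
      map_smul' := fun _ _ => rfl }
  exact h.of_retract s r fun _ => rfl

variable (M : Type u) [AddCommGroup M] [Module A M] [Module R M] [IsScalarTower R A M]
  [Module.Finite A M]

lemma dual_injective_of_projective (hE : Module.Injective R E) [Module.Projective A M] :
    Module.Injective Aᵐᵒᵖ (M →ₗ[R] E) := by
  classical
  obtain ⟨n, π, hπ⟩ := Module.Finite.exists_fin' A M
  obtain ⟨σ, hσ⟩ := Module.projective_lifting_property π LinearMap.id hπ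
  have := dual_self_injective (A := A) hE
  have h : Module.Injective Aᵐᵒᵖ (Fin n → (A →ₗ[R] E)) := inferInstance
  refine h.of_retract
    (LinearMap.pi fun i => dualTranspose R E (π ∘ₗ LinearMap.single A (fun _ => A) i))
    (∑ i, dualTranspose R E (LinearMap.proj i ∘ₗ σ) ∘ₗ LinearMap.proj i) fun f => ?_
  ext x
  have hx : x = ∑ i, π (Pi.single i (σ x i)) := by
    rw [← map_sum, Finset.univ_sum_single]
    exact (LinearMap.congr_fun hσ x).symm
  conv_rhs => rw [hx, map_sum]
  rw [LinearMap.sum_apply, LinearMap.sum_apply]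
  rfl

variable [Module.Finite R A]

/-- A free presentation `π` of `M` has a transpose that splits; by reflexivity the splitting is
itself the transpose of a section of `π`. -/
lemma projective_of_dual_injective (hE : IsMatlisModule R E)
    (h : Module.Injective Aᵐᵒᵖ (M →ₗ[R] E)) : Module.Projective A M := by
  obtain ⟨n, π, hπ⟩ := Module.Finite.exists_fin' A M
  obtain ⟨s, hs⟩ := h.exists_retraction (f := dualTranspose R E π) fun f g hfg =>
    LinearMap.ext fun x => by
      obtain ⟨y, rfl⟩ := hπ x
      exact LinearMap.congr_fun hfg y
  -- the section of `π` is obtained from `s` by reflexivity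
  have hs_add (f g : (Fin n → A) →ₗ[R] E) (x : M) : s (f + g) x = s f x + s g x := by
    rw [map_add]; rfl
  -- `s` is given as `Aᵐᵒᵖ`-linear; it is also `R`-linear because `R` acts through its image in `A`.
  have hs_smul (r : R) (f : (Fin n → A) →ₗ[R] E) (x : M) : s (r • f) x = r • s f x := by
    have h1 : r • f = op (algebraMap R A r) • f := LinearMap.ext fun y => by
      rw [dual_smul_apply, unop_op, algebraMap_smul, map_smul]
      rfl
    rw [h1, map_smul, dual_smul_apply, unop_op, algebraMap_smul, map_smul]
  choose σ hσ using fun x : M => hE.exists_eval (Fin n → A)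
    { toFun := fun f => s f x, map_add' := fun f g => hs_add f g x,
      map_smul' := fun r f => hs_smul r f x }
  have hσ' (x : M) (f : (Fin n → A) →ₗ[R] E) : f (σ x) = s f x := (hσ x f).symm
  have sep {N : Type u} [AddCommGroup N] [Module R N] {x y : N}
      (h : ∀ f : N →ₗ[R] E, f x = f y) : x = y := by
    by_contra hne
    obtain ⟨f, hf⟩ := hE.exists_ne_zero N (x - y) (sub_ne_zero.2 hne)
    exact hf (by rw [map_sub, h f, sub_self])
  let σ' : M →ₗ[A] (Fin n → A) :=
    { toFun := σ
      map_add' := fun x y => sep fun f => by rw [map_add, hσ', hσ', hσ', map_add]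
      map_smul' := fun a x => sep fun f => by
        have h1 := hσ' x (op a • f)
        rw [map_smul, dual_smul_apply, dual_smul_apply, unop_op] at h1
        rw [hσ', RingHom.id_apply, h1] }
  refine Module.Projective.of_split σ' π (LinearMap.ext fun x => sep fun g => ?_)
  have h1 := hσ' x (dualTranspose R E π g)
  rw [hs] at h1
  exact h1

/-- Duality turns the syzygy sequence of `M` into a sequence with injective middle term, so the two
dimension shifts run in parallel. -/
lemma hasProjectiveDimensionLT_iff_dual (hE : IsMatlisModule R E) (n : ℕ) [IsArtinianRing R] :
    HasProjectiveDimensionLT (ModuleCat.of A M) (n + 1) ↔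
      HasInjectiveDimensionLT (ModuleCat.of Aᵐᵒᵖ (M →ₗ[R] E)) (n + 1) := by
  have : IsNoetherianRing A := isNoetherian_of_tower R inferInstance
  induction n generalizing M with
  | zero =>
    rw [zero_add, hasProjectiveDimensionLT_one_iff, hasInjectiveDimensionLT_one_iff]
    exact ⟨fun _ => dual_injective_of_projective M hE.injective,
      projective_of_dual_injective M hE⟩
  | succ n ih =>
    obtain ⟨k, π, hπ⟩ := Module.Finite.exists_fin' A M
    have hexact : Function.Exact (dualTranspose R E π)
        (dualTranspose R E (LinearMap.ker π).subtype) := by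
      intro f
      constructor
      · intro hf
        obtain ⟨g, hg⟩ := exists_descend (p := π.restrictScalars R) hπ f
          fun x hx => LinearMap.congr_fun hf ⟨x, hx⟩
        exact ⟨g, LinearMap.ext hg⟩
      · rintro ⟨g, rfl⟩
        ext x
        change g (π x) = 0
        rw [LinearMap.mem_ker.1 x.2, map_zero]
    refine (hasProjectiveDimensionLT_right_iff (LinearMap.ker π).subtype_injective
      (LinearMap.exact_subtype_ker_map π) hπ n).trans ((ih (LinearMap.ker π)).trans
      (hasInjectiveDimensionLT_left_iff (f := dualTranspose R E π)
        (g := dualTranspose R E (LinearMap.ker π).subtype) ?_ hexact ?_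
        (dual_injective_of_projective _ hE.injective) n).symm)
    · intro f g hfg
      ext x
      obtain ⟨y, rfl⟩ := hπ x
      exact LinearMap.congr_fun hfg y
    · intro f
      exact (hE.injective.out ((LinearMap.ker π).subtype.restrictScalars R)
        (LinearMap.ker π).subtype_injective f).imp fun h hh => LinearMap.ext hh

end ArtinDuality

/-! ### The injective cogenerator of an artin algebra. -/

section ArtinAlgebra

attribute [local instance] regularDualModule dualModule

instance IsArtinAlgebra.isNoetherianRing (A : Type u) [Ring A] [IsArtinAlgebra A] :
    IsNoetherianRing A := by
  obtain ⟨R, _, _, _, _⟩ := IsArtinAlgebra.exists_base (A := A)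
  exact isNoetherian_of_tower R inferInstance

instance IsArtinAlgebra.isArtinianRing (A : Type u) [Ring A] [IsArtinAlgebra A] :
    IsArtinianRing A := by
  obtain ⟨R, _, _, _, _⟩ := IsArtinAlgebra.exists_base (A := A)
  exact isArtinian_of_tower R inferInstance

/-- An artin algebra has a finitely generated injective cogenerator on the left, which has finite
projective dimension if and only if the regular right module has finite injective dimension. -/
lemma exists_injective_cogenerator (A : Type u) [Ring A] [IsArtinAlgebra A] :
    ∃ (W : Type u) (_ : AddCommGroup W) (_ : Module A W), Module.Finite A W ∧
      Module.Injective A W ∧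
      (∀ (M : Type u) [AddCommGroup M] [Module A M] [Module.Finite A M],
        ∃ (n : ℕ) (f : M →ₗ[A] (Fin n → W)), Function.Injective f) ∧
      (FiniteInjDim Aᵐᵒᵖ A ↔ FiniteProjDim A W) := by
  obtain ⟨R, _, _, _, _⟩ := IsArtinAlgebra.exists_base (A := A)
  obtain ⟨E, _, _, hE⟩ := exists_isMatlisModule R
  have : IsScalarTower R A (A →ₗ[R] E) := ⟨fun r a f => LinearMap.ext fun x => by
    change f (x * (r • a)) = r • f (x * a)
    rw [mul_smul_comm, map_smul]⟩
  have := hE.finite_hom A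
  have : Module.Finite A (A →ₗ[R] E) := Module.Finite.of_restrictScalars_finite R _ _
  refine ⟨A →ₗ[R] E, inferInstance, inferInstance, this, regularDual_injective hE.injective,
    fun M _ _ _ => exists_embedding_pi fun x hx => ?_, ?_⟩
  · let : Module R M := Module.compHom M (algebraMap R A)
    have : IsScalarTower R A M := ⟨fun r a x => by
      change (r • a) • x = algebraMap R A r • (a • x)
      rw [Algebra.smul_def, mul_smul]⟩
    obtain ⟨f, hf⟩ := hE.exists_ne_zero M x hx
    -- The coinduced map `m ↦ (a ↦ f (a • m))`; its value at `x` is nonzero because evaluating at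
    -- `1` returns `f x`.
    refine ⟨{ toFun := fun m => f ∘ₗ (LinearMap.toSpanSingleton A M m).restrictScalars R
              map_add' := fun m m' => LinearMap.ext fun a => by
                change f (a • (m + m')) = f (a • m) + f (a • m')
                rw [smul_add, map_add]
              map_smul' := fun b m => LinearMap.ext fun a => by
                change f (a • b • m) = f ((a * b) • m)
                rw [mul_smul] }, fun h0 => hf ?_⟩
    have : f ((1 : A) • x) = 0 := LinearMap.congr_fun h0 1
    rwa [one_smul] at this
  -- `A` is isomorphic, as a right module, to the dual of `W`.
  · let ev : A →ₗ[Aᵐᵒᵖ] ((A →ₗ[R] E) →ₗ[R] E) :=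
      { toFun := fun a => LinearMap.applyₗ a
        map_add' := fun a b => map_add _ a b
        map_smul' := fun b a => rfl }
    have hev : Function.Bijective ev := by
      refine ⟨(injective_iff_map_eq_zero ev).2 fun a ha => ?_, fun φ => ?_⟩
      · by_contra h0
        obtain ⟨f, hf⟩ := hE.exists_ne_zero A a h0
        exact hf (LinearMap.congr_fun ha f)
      · obtain ⟨a, ha⟩ := hE.exists_eval A φ
        exact ⟨a, LinearMap.ext fun f => (ha f).symm⟩
    have h1 : FiniteInjDim Aᵐᵒᵖ A ↔ FiniteInjDim Aᵐᵒᵖ ((A →ₗ[R] E) →ₗ[R] E) :=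
      ⟨fun h => h.congr (LinearEquiv.ofBijective ev hev).symm,
        fun h => h.congr (LinearEquiv.ofBijective ev hev)⟩
    rw [h1, finiteInjDim_iff, finiteProjDim_iff]
    exact exists_congr fun n => (hasProjectiveDimensionLT_iff_dual (A →ₗ[R] E) hE n).symm

end ArtinAlgebra

/-! ### Closure properties of the modules perpendicular to `S`. -/

section Perp

variable (A : Type u) [Ring A] (S : Type u) [AddCommGroup S] [Module A S]

/-- The module `Y` is right perpendicular to `S`. -/
structure IsPerp (Y : Type u) [AddCommGroup Y] [Module A Y] : Prop where
  hom_eq_zero : ∀ f : S →ₗ[A] Y, f = 0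
  subsingleton_ext : Subsingleton (Ext (ModuleCat.of A S) (ModuleCat.of A Y) 1)

variable {A S}

/-- For `K` the kernel of a projective cover-like presentation `A → S`, this is right exactness of
`Ext¹(S, -)`, that is, vanishing of `Ext²(S, -)`. -/
lemma ExtendsFrom.of_surjective {K : Submodule A A} [Module.Projective A K]
    {X Y : Type u} [AddCommGroup X] [Module A X] [AddCommGroup Y] [Module A Y]
    (hX : ExtendsFrom K X) {π : X →ₗ[A] Y} (hπ : Function.Surjective π) : ExtendsFrom K Y := by
  intro g
  obtain ⟨g', hg'⟩ := Module.projective_lifting_property π g hπ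
  obtain ⟨h, hh⟩ := hX g'
  exact ⟨π ∘ₗ h, fun k => by rw [LinearMap.comp_apply, hh, ← LinearMap.comp_apply, hg']⟩

lemma ExtendsFrom.of_injective (K : Submodule A A) {J : Type u} [AddCommGroup J] [Module A J]
    (hJ : Module.Injective A J) : ExtendsFrom K J :=
  fun g => hJ.out K.subtype K.subtype_injective g

section Presentation

variable {p : A →ₗ[A] S} (hp : Function.Surjective p)

include hp

/-- If all homomorphisms from `S` to `X` have values in `ker π` and `Ext¹(S, ker π) = 0`, then
there is no nonzero homomorphism from `S` to the image of `π`. -/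
lemma hom_eq_zero_of_surjective {X Y : Type u} [AddCommGroup X] [Module A X] [AddCommGroup Y]
    [Module A Y] {π : X →ₗ[A] Y} (hπ : Function.Surjective π)
    (hX : ∀ (g : S →ₗ[A] X) (s : S), π (g s) = 0)
    (hK : ExtendsFrom (LinearMap.ker p) (LinearMap.ker π)) (f : S →ₗ[A] Y) : f = 0 := by
  obtain ⟨h, hh⟩ := Module.projective_lifting_property π (f ∘ₗ p) hπ
  have hh' (a : A) : π (h a) = f (p a) := LinearMap.congr_fun hh a
  -- On `ker p` the lift `h` takes values in `ker π`. Subtracting an extension `w` of this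
  -- restriction lets `h` descend to a map `d : S → X` lifting `f`, and `π` kills the values of `d`
  -- by assumption.
  obtain ⟨w, hw⟩ := hK ((h ∘ₗ (LinearMap.ker p).subtype).codRestrict (LinearMap.ker π) fun k => by
    rw [LinearMap.mem_ker, LinearMap.comp_apply, Submodule.subtype_apply, hh',
      LinearMap.mem_ker.1 k.2, map_zero])
  obtain ⟨d, hd⟩ := exists_descend hp (h - (LinearMap.ker π).subtype ∘ₗ w) fun k hk => by
    simpa [sub_eq_zero] using (congrArg Subtype.val (hw ⟨k, hk⟩)).symm
  ext s
  obtain ⟨a, rfl⟩ := hp s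
  have h1 := hX d (p a)
  rw [hd, LinearMap.sub_apply, map_sub, hh', LinearMap.comp_apply, Submodule.subtype_apply,
    LinearMap.mem_ker.1 (w a).2, sub_zero] at h1
  rw [h1, LinearMap.zero_apply]

lemma isPerp_iff {Y : Type u} [AddCommGroup Y] [Module A Y] :
    IsPerp A S Y ↔ (∀ f : S →ₗ[A] Y, f = 0) ∧ ExtendsFrom (LinearMap.ker p) Y := by
  rw [extendsFrom_ker_iff hp]
  exact ⟨fun h => ⟨h.1, h.2⟩, fun h => ⟨h.1, h.2⟩⟩

lemma IsPerp.of_surjective {X Y : Type u} [AddCommGroup X] [Module A X] [AddCommGroup Y]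
    [Module A Y] [Module.Projective A (LinearMap.ker p)] (hX : IsPerp A S X) {π : X →ₗ[A] Y}
    (hπ : Function.Surjective π) (hK : ExtendsFrom (LinearMap.ker p) (LinearMap.ker π)) :
    IsPerp A S Y := by
  refine (isPerp_iff hp).2 ⟨hom_eq_zero_of_surjective hp hπ (fun g s => ?_) hK,
    ((isPerp_iff hp).1 hX).2.of_surjective hπ⟩
  rw [hX.hom_eq_zero g, LinearMap.zero_apply, map_zero]

end Presentation

variable (A S) in
lemma IsLocalizable.exists_presentation [hS : IsLocalizable A S] :
    ∃ p : A →ₗ[A] S, Function.Surjective p ∧ Module.Projective A (LinearMap.ker p) ∧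
      ExtendsFrom (LinearMap.ker p) S := by
  have := hS.isSimple
  have := IsSimpleModule.nontrivial A S
  obtain ⟨s, hs⟩ := exists_ne (0 : S)
  have hp : Function.Surjective (LinearMap.toSpanSingleton A S s) :=
    IsSimpleModule.toSpanSingleton_surjective A hs
  exact ⟨_, hp, projective_ker hp ((projectiveDimension_le_iff _ 1).1 hS.projectiveDimension_le_one),
    (extendsFrom_ker_iff hp S).2 hS.subsingleton_ext_one⟩

lemma IsPerp.pi {X : Type u} [AddCommGroup X] [Module A X] [IsLocalizable A S]
    (hX : IsPerp A S X) (n : ℕ) : IsPerp A S (Fin n → X) := by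
  obtain ⟨p, hp, _, -⟩ := IsLocalizable.exists_presentation A S
  refine (isPerp_iff hp).2 ⟨fun f => ?_, ((isPerp_iff hp).1 hX).2.pi (Fin n)⟩
  ext s i
  exact LinearMap.congr_fun (hX.hom_eq_zero (LinearMap.proj i ∘ₗ f)) s

/-- Cokernels of maps between modules perpendicular to `S` are perpendicular to `S`. -/
lemma IsPerp.of_exact {X Y Z : Type u} [AddCommGroup X] [Module A X] [AddCommGroup Y]
    [Module A Y] [AddCommGroup Z] [Module A Z] [IsLocalizable A S] (hX : IsPerp A S X)
    (hY : IsPerp A S Y) {f : X →ₗ[A] Y} {g : Y →ₗ[A] Z} (hfg : Function.Exact f g)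
    (hg : Function.Surjective g) : IsPerp A S Z := by
  obtain ⟨p, hp, _, -⟩ := IsLocalizable.exists_presentation A S
  -- The kernel of `g` is a quotient of `X`, so it inherits the vanishing of `Ext¹(S, -)`.
  refine hY.of_surjective hp hg (ExtendsFrom.of_surjective ((isPerp_iff hp).1 hX).2
    (π := f.codRestrict (LinearMap.ker g) fun x => hfg.apply_apply_eq_zero x) fun y => ?_)
  obtain ⟨x, hx⟩ := (hfg y.1).1 y.2
  exact ⟨x, Subtype.ext hx⟩

end Perp

lemma PerpCat.isPerp {A S : Type u} [Ring A] [AddCommGroup S] [Module A S] (Y : PerpCat A S) :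
    IsPerp A S Y.obj :=
  ⟨fun _ => Y.property.1.elim _ _, Y.property.2⟩

/-! ### Finitely generated `L(A)`-modules as modules perpendicular to `S`. -/

section RetractionModules

variable {A : Type u} [Ring A] [IsArtinAlgebra A]
  {S : Type u} [AddCommGroup S] [Module A S] [IsLocalizable A S]

instance (Y : PerpCat A S) : IsScalarTower A (RetractionAlgebra A S) Y.obj :=
  ⟨fun a x y => map_smul (extendRightMul Y y) a x⟩

instance : IsScalarTower A (RetractionAlgebra A S) (RetractionAlgebra A S) :=
  inferInstanceAs (IsScalarTower A (RetractionAlgebra A S) (perpA A S).obj)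

instance : Module.Finite A (RetractionAlgebra A S) :=
  inferInstanceAs (Module.Finite A (perpA A S).obj)

lemma RetractionAlgebra.isPerp : IsPerp A S (RetractionAlgebra A S) :=
  (perpA A S).isPerp

variable (A S) in
-- The base ring stays central in `L(A)`: left multiplication by a scalar is `A`-linear and agrees
-- with right multiplication on the image of `η_A`, hence everywhere by uniqueness of extensions.
instance RetractionAlgebra.isArtinAlgebra : IsArtinAlgebra (RetractionAlgebra A S) := by
  obtain ⟨R, _, _, _, _⟩ := IsArtinAlgebra.exists_base (A := A)
  let f : R →+* RetractionAlgebra A S := (leftRetraction A S).comp (algebraMap R A)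
  have hf (r : R) (x : RetractionAlgebra A S) : f r * x = algebraMap R A r • x :=
    leftRetraction_smul (perpA A S) (algebraMap R A r) x
  have hcomm (r : R) (x : RetractionAlgebra A S) : f r * x = x * f r := by
    rw [hf]
    let m : RetractionAlgebra A S →ₗ[A] RetractionAlgebra A S :=
      { toFun := fun x => algebraMap R A r • x
        map_add' := smul_add _
        map_smul' := fun a x => by
          rw [← mul_smul, Algebra.commutes, mul_smul, RingHom.id_apply] }
    have : m = starRight (f r) := retraction_end_ext fun a => by
      rw [starRight_eta]
      change algebraMap R A r • etaLinear A S a = a • etaLinear A S (algebraMap R A r)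
      rw [← map_smul, ← map_smul, smul_eq_mul, smul_eq_mul, Algebra.commutes]
    exact LinearMap.congr_fun this x
  let : Algebra R (RetractionAlgebra A S) := f.toAlgebra' hcomm
  have : IsScalarTower R A (RetractionAlgebra A S) := ⟨fun r a x => by
    rw [Algebra.smul_def, mul_smul, ← hf, Algebra.smul_def]
    rfl⟩
  exact ⟨R, inferInstance, inferInstance, inferInstance, Module.Finite.trans A _⟩

section

variable (Y : Type u) [AddCommGroup Y] [Module A Y] [Module (RetractionAlgebra A S) Y]
  [IsScalarTower A (RetractionAlgebra A S) Y] [Module.Finite (RetractionAlgebra A S) Y]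

/-- Finitely generated `L(A)`-modules are perpendicular to `S`. -/
lemma isPerp_of_finite : IsPerp A S Y := by
  -- `L(A)` is noetherian, so `Y` is the cokernel of a map between finite powers of `L(A)`.
  obtain ⟨n, π, hπ⟩ := Module.Finite.exists_fin' (RetractionAlgebra A S) Y
  obtain ⟨m, σ, hσ⟩ := Module.Finite.exists_fin' (RetractionAlgebra A S) (LinearMap.ker π)
  refine (RetractionAlgebra.isPerp.pi m).of_exact (RetractionAlgebra.isPerp.pi n)
    (f := ((LinearMap.ker π).subtype ∘ₗ σ).restrictScalars A) (g := π.restrictScalars A)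
    (fun y => ⟨fun hy => ?_, ?_⟩) hπ
  · obtain ⟨x, hx⟩ := hσ ⟨y, hy⟩
    exact ⟨x, congrArg Subtype.val hx⟩
  · rintro ⟨x, rfl⟩
    exact (σ x).2

end

lemma PerpCat.exists_module (Y : PerpCat A S) :
    ∃ _ : Module (RetractionAlgebra A S) Y.obj, IsScalarTower A (RetractionAlgebra A S) Y.obj ∧
      Module.Finite (RetractionAlgebra A S) Y.obj :=
  ⟨inferInstance, inferInstance,
    Module.Finite.of_restrictScalars_finite A (RetractionAlgebra A S) Y.obj⟩

/-- Finitely generated modules perpendicular to `S` are `L(A)`-modules. -/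
lemma IsPerp.exists_module {Y : Type u} [AddCommGroup Y] [Module A Y] [Module.Finite A Y]
    (hY : IsPerp A S Y) :
    ∃ _ : Module (RetractionAlgebra A S) Y, IsScalarTower A (RetractionAlgebra A S) Y ∧
      Module.Finite (RetractionAlgebra A S) Y :=
  PerpCat.exists_module
    ⟨FGModuleCat.of A Y, subsingleton_of_forall_eq 0 hY.hom_eq_zero, hY.subsingleton_ext⟩

lemma IsPerp.retraction_hom_ext {Y : Type u} [AddCommGroup Y] [Module A Y] [Module.Finite A Y]
    (hY : IsPerp A S Y) {f g : RetractionAlgebra A S →ₗ[A] Y}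
    (h : ∀ a, f (etaLinear A S a) = g (etaLinear A S a)) : f = g :=
  _root_.retraction_hom_ext (Y :=
    ⟨FGModuleCat.of A Y, subsingleton_of_forall_eq 0 hY.hom_eq_zero, hY.subsingleton_ext⟩) h

section

variable {Y Z : Type u} [AddCommGroup Y] [Module A Y] [Module (RetractionAlgebra A S) Y]
  [IsScalarTower A (RetractionAlgebra A S) Y] [AddCommGroup Z] [Module A Z]
  [Module (RetractionAlgebra A S) Z] [IsScalarTower A (RetractionAlgebra A S) Z]
  [Module.Finite (RetractionAlgebra A S) Z]

/-- The `A`-linear maps between `L(A)`-modules are `L(A)`-linear. -/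
lemma map_retraction_smul (f : Y →ₗ[A] Z) (x : RetractionAlgebra A S) (y : Y) :
    f (x • y) = x • f y := by
  have : Module.Finite A Z := Module.Finite.trans (RetractionAlgebra A S) Z
  -- Both sides are `A`-linear in `x` and agree on the image of `η_A`; as `Z` is perpendicular to
  -- `S`, they coincide.
  have key : f ∘ₗ (LinearMap.toSpanSingleton (RetractionAlgebra A S) Y y).restrictScalars A =
      (LinearMap.toSpanSingleton (RetractionAlgebra A S) Z (f y)).restrictScalars A := by
    refine (isPerp_of_finite (S := S) Z).retraction_hom_ext fun a => ?_
    have h : etaLinear A S a = a • (1 : RetractionAlgebra A S) := by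
      change etaLinear A S a = a • etaLinear A S 1
      rw [← map_smul, smul_eq_mul, mul_one]
    rw [h, map_smul, map_smul]
    congr 1
    change f ((1 : RetractionAlgebra A S) • y) = (1 : RetractionAlgebra A S) • f y
    rw [one_smul, one_smul]
  exact LinearMap.congr_fun key x

variable (S) in
/-- An `A`-linear map between `L(A)`-modules, as an `L(A)`-linear map. -/
def LinearMap.extendScalarsRetraction (f : Y →ₗ[A] Z) : Y →ₗ[RetractionAlgebra A S] Z where
  toFun := f
  map_add' := map_add f
  map_smul' := map_retraction_smul f

end

end RetractionModules

/-! ### The `S`-isotypic component as a torsion submodule. -/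

section Torsion

variable {A : Type u} [Ring A] {S : Type u} [AddCommGroup S] [Module A S] [IsSimpleModule A S]
  {X Y : Type u} [AddCommGroup X] [Module A X] [AddCommGroup Y] [Module A Y]

lemma apply_mem_isotypicComponent (g : S →ₗ[A] X) (s : S) : g s ∈ isotypicComponent A X S := by
  rcases g.injective_or_eq_zero with hg | rfl
  · exact (le_sSup ⟨(LinearEquiv.ofInjective g hg).symm⟩ :
      LinearMap.range g ≤ isotypicComponent A X S) ⟨s, rfl⟩
  · simp

lemma isotypicComponent_le_ker {S : Type u} [AddCommGroup S] [Module A S]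
    (hY : ∀ f : S →ₗ[A] Y, f = 0) (f : X →ₗ[A] Y) :
    isotypicComponent A X S ≤ LinearMap.ker f :=
  sSup_le fun m ⟨e⟩ x hx => by
    have := LinearMap.congr_fun (hY (f ∘ₗ m.subtype ∘ₗ e.symm.toLinearMap)) (e ⟨x, hx⟩)
    simpa using this

lemma exists_isotypicComponent_equiv [IsNoetherian A X] :
    ∃ n, Nonempty (isotypicComponent A X S ≃ₗ[A] (Fin n → S)) :=
  (IsIsotypicOfType.isotypicComponent A X S).linearEquiv_fun

/-- The preimage embeds in an `S`-isotypic semisimple module, so it is a power of `S` and each of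
its elements is a sum of images of maps `S → X`. -/
lemma comap_isotypicComponent_le [IsNoetherian A X] {j : X →ₗ[A] Y} (hj : Function.Injective j) :
    (isotypicComponent A Y S).comap j ≤ isotypicComponent A X S := by
  let N := (isotypicComponent A Y S).comap j
  let k : N →ₗ[A] isotypicComponent A Y S := j.restrict fun x hx => hx
  have hk : Function.Injective k := fun x y h => Subtype.ext (hj (congrArg Subtype.val h))
  have := IsSemisimpleModule.of_injective k hk
  obtain ⟨n, ⟨e⟩⟩ :=
    ((IsIsotypicOfType.isotypicComponent A Y S).of_injective k hk).linearEquiv_fun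
  intro x hx
  have h : x = ∑ i, (N.subtype ∘ₗ e.symm.toLinearMap ∘ₗ LinearMap.single A (fun _ => S) i)
      (e ⟨x, hx⟩ i) := by
    simp only [LinearMap.comp_apply, LinearMap.single_apply, LinearEquiv.coe_coe]
    rw [← map_sum, ← map_sum, Finset.univ_sum_single, LinearEquiv.symm_apply_apply]
    rfl
  rw [h]
  exact Submodule.sum_mem _ fun i _ => apply_mem_isotypicComponent _ _

end Torsion

/-! ### Universal maps to modules perpendicular to `S`. -/

section IsReflection

variable {A : Type u} [Ring A] {S : Type u} [AddCommGroup S] [Module A S]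

variable (A S) in
/-- `η : X → Y` is a universal map to a module perpendicular to `S`. -/
structure IsReflection {X Y : Type u} [AddCommGroup X] [Module A X] [AddCommGroup Y] [Module A Y]
    (η : X →ₗ[A] Y) : Prop where
  isPerp : IsPerp A S Y
  finite : Module.Finite A Y
  existsUnique : ∀ (Z : Type u) [AddCommGroup Z] [Module A Z] [Module.Finite A Z],
    IsPerp A S Z → ∀ f : X →ₗ[A] Z, ∃! g : Y →ₗ[A] Z, g ∘ₗ η = f

namespace IsReflection

variable {X Y X' Y' X'' Y'' : Type u} [AddCommGroup X] [Module A X] [AddCommGroup Y] [Module A Y]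
  [AddCommGroup X'] [Module A X'] [AddCommGroup Y'] [Module A Y']
  [AddCommGroup X''] [Module A X''] [AddCommGroup Y''] [Module A Y'']
  {η : X →ₗ[A] Y} {η' : X' →ₗ[A] Y'} {η'' : X'' →ₗ[A] Y''}

lemma hom_ext (h : IsReflection A S η) {Z : Type u} [AddCommGroup Z] [Module A Z]
    [Module.Finite A Z] (hZ : IsPerp A S Z) {f g : Y →ₗ[A] Z} (hfg : ∀ x, f (η x) = g (η x)) :
    f = g :=
  (h.existsUnique Z hZ (g ∘ₗ η)).unique (LinearMap.ext hfg) rfl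

lemma exists_extension (h : IsReflection A S η) {Z : Type u} [AddCommGroup Z] [Module A Z]
    [Module.Finite A Z] (hZ : IsPerp A S Z) (f : X →ₗ[A] Z) :
    ∃ g : Y →ₗ[A] Z, ∀ x, g (η x) = f x := by
  obtain ⟨g, hg, -⟩ := h.existsUnique Z hZ f
  exact ⟨g, LinearMap.congr_fun hg⟩

lemma exists_map (h : IsReflection A S η) (h' : IsReflection A S η') (f : X →ₗ[A] X') :
    ∃ g : Y →ₗ[A] Y', ∀ x, g (η x) = η' (f x) :=
  have := h'.finite
  h.exists_extension h'.isPerp (η' ∘ₗ f)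

/-- Reflections are right exact. -/
lemma exact_map [IsLocalizable A S] (h : IsReflection A S η) (h' : IsReflection A S η') (h'' : IsReflection A S η'')
    {f : X →ₗ[A] X'} {g : X' →ₗ[A] X''} (hfg : Function.Exact f g) (hg : Function.Surjective g)
    {f' : Y →ₗ[A] Y'} {g' : Y' →ₗ[A] Y''} (hf' : ∀ x, f' (η x) = η' (f x))
    (hg' : ∀ x, g' (η' x) = η'' (g x)) : Function.Exact f' g' ∧ Function.Surjective g' := by
  have := h'.finite
  have := h''.finite
  constructor
  · have hcomp : g' ∘ₗ f' = 0 := h.hom_ext h''.isPerp fun x => by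
      rw [LinearMap.comp_apply, hf', hg', hfg.apply_apply_eq_zero, map_zero, LinearMap.zero_apply]
    -- Since the cokernel of `f'` is perpendicular to `S`, the universal property of `η''` factors
    -- the quotient map through `g'`, which bounds `ker g'` by the range of `f'`.
    have hC : IsPerp A S (Y' ⧸ LinearMap.range f') :=
      h.isPerp.of_exact h'.isPerp (LinearMap.exact_map_mkQ_range f') (Submodule.mkQ_surjective _)
    obtain ⟨v, hv⟩ : ∃ v : X'' →ₗ[A] (Y' ⧸ LinearMap.range f'),
        ∀ x, v (g x) = (LinearMap.range f').mkQ (η' x) :=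
      exists_descend hg ((LinearMap.range f').mkQ ∘ₗ η') fun x hx => by
        obtain ⟨y, rfl⟩ := (hfg x).1 hx
        exact (Submodule.Quotient.mk_eq_zero _).2 ⟨η y, hf' y⟩
    obtain ⟨w, hw⟩ := h''.exists_extension hC v
    have hwg : w ∘ₗ g' = (LinearMap.range f').mkQ := h'.hom_ext hC fun x => by
      rw [LinearMap.comp_apply, hg', hw, hv]
    refine fun y => ⟨fun hy => ?_, ?_⟩
    · have := LinearMap.congr_fun hwg y
      rw [LinearMap.comp_apply, hy, map_zero] at this
      exact (Submodule.Quotient.mk_eq_zero _).1 this.symm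
    · rintro ⟨x, rfl⟩
      exact LinearMap.congr_fun hcomp x
  · have hC : IsPerp A S (Y'' ⧸ LinearMap.range g') :=
      h'.isPerp.of_exact h''.isPerp (LinearMap.exact_map_mkQ_range g') (Submodule.mkQ_surjective _)
    have h0 : (LinearMap.range g').mkQ = 0 := h''.hom_ext hC fun x => by
      obtain ⟨x, rfl⟩ := hg x
      exact (Submodule.Quotient.mk_eq_zero _).2 ⟨η' x, hg' x⟩
    intro y
    exact (Submodule.Quotient.mk_eq_zero _).1 (LinearMap.congr_fun h0 y)

end IsReflection

end IsReflection

/-! ### Kernel and cokernel of the reflection; exactness. -/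

section Reflection

variable {A : Type u} [Ring A] [IsArtinAlgebra A]
  {S : Type u} [AddCommGroup S] [Module A S] [IsLocalizable A S]

/-- Maps from `S` land in the isotypic component, which is a power of `S` and so has no `Ext¹` from
`S`; and `Ext¹(S, -)` vanishes on quotients of injectives. -/
lemma isPerp_quotient_isotypicComponent {J : Type u} [AddCommGroup J] [Module A J]
    [Module.Finite A J] (hJ : Module.Injective A J) :
    IsPerp A S (J ⧸ isotypicComponent A J S) := by
  have := IsLocalizable.isSimple (A := A) (S := S)
  obtain ⟨p, hp, _, hS⟩ := IsLocalizable.exists_presentation A S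
  obtain ⟨n, ⟨e⟩⟩ := exists_isotypicComponent_equiv (A := A) (S := S) (X := J)
  have hsurj := (isotypicComponent A J S).mkQ_surjective
  refine (isPerp_iff hp).2 ⟨hom_eq_zero_of_surjective hp hsurj (fun g s => ?_) ?_,
    (ExtendsFrom.of_injective _ hJ).of_surjective hsurj⟩
  · exact (Submodule.Quotient.mk_eq_zero _).2 (apply_mem_isotypicComponent g s)
  · rw [Submodule.ker_mkQ]
    exact (hS.pi (Fin n)).congr e.symm

variable (A S) in
/-- A finitely generated module embeds modulo its `S`-isotypic component into a module
perpendicular to `S`. -/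
lemma exists_map_isPerp (X : Type u) [AddCommGroup X] [Module A X] [Module.Finite A X] :
    ∃ (Z : Type u) (_ : AddCommGroup Z) (_ : Module A Z) (f : X →ₗ[A] Z), Module.Finite A Z ∧
      IsPerp A S Z ∧ LinearMap.ker f ≤ isotypicComponent A X S := by
  have := IsLocalizable.isSimple (A := A) (S := S)
  obtain ⟨W, _, _, _, hW, hemb, -⟩ := exists_injective_cogenerator A
  obtain ⟨n, j, hj⟩ := hemb X
  refine ⟨_, inferInstance, inferInstance, (isotypicComponent A (Fin n → W) S).mkQ ∘ₗ j,
    inferInstance, isPerp_quotient_isotypicComponent inferInstance, ?_⟩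
  rw [LinearMap.ker_comp, Submodule.ker_mkQ]
  exact comap_isotypicComponent_le hj

lemma isReflection_perpUnit (X : FGModuleCat.{u} A) :
    IsReflection A S ((perpUnit A S).app X).hom.hom where
  isPerp := ((iLambda A S).obj X).isPerp
  finite := inferInstanceAs (Module.Finite A ((perpL A S).obj X))
  existsUnique Z _ _ _ hZ f := by
    let Z' : PerpCat A S :=
      ⟨FGModuleCat.of A Z, subsingleton_of_forall_eq 0 hZ.hom_eq_zero, hZ.subsingleton_ext⟩
    have key (g : (iLambda A S).obj X ⟶ Z') : ((perpAdj A S).homEquiv X Z' g).hom.hom =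
        g.hom.hom.hom ∘ₗ ((perpUnit A S).app X).hom.hom := by
      rw [Adjunction.homEquiv_unit]
      rfl
    let f' : X ⟶ (perpInclusion A S).obj Z' := ObjectProperty.homMk (ModuleCat.ofHom f)
    refine ⟨(((perpAdj A S).homEquiv X Z').symm f').hom.hom.hom, ?_, fun g hg => ?_⟩
    · change _ ∘ₗ _ = _
      rw [← key, Equiv.apply_symm_apply]
      rfl
    · let g' : (iLambda A S).obj X ⟶ Z' :=
        ObjectProperty.homMk (ObjectProperty.homMk (ModuleCat.ofHom g))
      have h1 : (perpAdj A S).homEquiv X Z' g' = f' := by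
        apply FGModuleCat.hom_ext
        rw [key]
        exact hg
      rw [← h1, Equiv.symm_apply_apply]
      rfl

lemma isReflection_etaLinear : IsReflection A S (etaLinear A S) :=
  isReflection_perpUnit (FGModuleCat.of A A)

variable (A S) in
lemma exists_isReflection (X : Type u) [AddCommGroup X] [Module A X] [Module.Finite A X] :
    ∃ (Y : Type u) (_ : AddCommGroup Y) (_ : Module A Y) (_ : Module (RetractionAlgebra A S) Y)
      (_ : IsScalarTower A (RetractionAlgebra A S) Y)
      (_ : Module.Finite (RetractionAlgebra A S) Y) (η : X →ₗ[A] Y), IsReflection A S η := by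
  have h := isReflection_perpUnit (S := S) (FGModuleCat.of A X)
  have := h.finite
  obtain ⟨h1, h2, h3⟩ := h.isPerp.exists_module
  exact ⟨_, _, _, h1, h2, h3, _, h⟩

namespace IsReflection

variable {X Y X' Y' : Type u} [AddCommGroup X] [Module A X] [AddCommGroup Y] [Module A Y]
  [AddCommGroup X'] [Module A X'] [AddCommGroup Y'] [Module A Y']
  {η : X →ₗ[A] Y} {η' : X' →ₗ[A] Y'}

/-- `X` maps to some module perpendicular to `S` with kernel inside the isotypic component, and that
map factors through `η`. -/
lemma ker_eq [Module.Finite A X] (h : IsReflection A S η) :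
    LinearMap.ker η = isotypicComponent A X S := by
  have := IsLocalizable.isSimple (A := A) (S := S)
  refine le_antisymm ?_ (isotypicComponent_le_ker h.isPerp.hom_eq_zero η)
  obtain ⟨Z, _, _, f, _, hZ, hf⟩ := exists_map_isPerp A S X
  obtain ⟨g, hg⟩ := h.exists_extension hZ f
  refine le_trans (fun x hx => ?_) hf
  rw [LinearMap.mem_ker, ← hg, LinearMap.mem_ker.1 hx, map_zero]

/-- By uniqueness of extensions, every map from the cokernel to a finitely generated module
perpendicular to `S` is zero; one of these maps has kernel inside the isotypic component. -/
lemma isotypicComponent_coker (h : IsReflection A S η) :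
    isotypicComponent A (Y ⧸ LinearMap.range η) S = ⊤ := by
  have := h.finite
  obtain ⟨Z, _, _, f, _, hZ, hf⟩ := exists_map_isPerp A S (Y ⧸ LinearMap.range η)
  have h0 : f ∘ₗ (LinearMap.range η).mkQ = 0 := h.hom_ext hZ fun x => by
    rw [LinearMap.comp_apply, Submodule.mkQ_apply,
      (Submodule.Quotient.mk_eq_zero _).2 (LinearMap.mem_range_self η x), map_zero,
      LinearMap.zero_apply]
  refine top_le_iff.1 (le_trans (fun y _ => ?_) hf)
  obtain ⟨y, rfl⟩ := (LinearMap.range η).mkQ_surjective y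
  exact LinearMap.congr_fun h0 y

/-- Reflections preserve injections. -/
lemma injective_map [Module.Finite A X] [Module.Finite A X'] (h : IsReflection A S η)
    (h' : IsReflection A S η') {f : X →ₗ[A] X'} (hf : Function.Injective f) {g : Y →ₗ[A] Y'}
    (hg : ∀ x, g (η x) = η' (f x)) : Function.Injective g := by
  have := IsLocalizable.isSimple (A := A) (S := S)
  have := h.finite
  -- `ker g` embeds in the cokernel of `η`: an element `η x` of it has `f x`, hence `x`, in the
  -- isotypic component, so it is zero. Thus `ker g` is generated by copies of `S`, of which `Y`
  -- contains none.
  let k : LinearMap.ker g →ₗ[A] Y ⧸ LinearMap.range η :=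
    (LinearMap.range η).mkQ ∘ₗ (LinearMap.ker g).subtype
  have hk : Function.Injective k := by
    refine (injective_iff_map_eq_zero k).2 fun y hy => ?_
    obtain ⟨x, hx⟩ := (Submodule.Quotient.mk_eq_zero _).1 hy
    have h1 : η' (f x) = 0 := by
      rw [← hg, hx]
      exact y.2
    have h2 : x ∈ LinearMap.ker η := by
      rw [h.ker_eq]
      refine comap_isotypicComponent_le hf ?_
      rw [Submodule.mem_comap, ← h'.ker_eq]
      exact h1
    exact Subtype.ext (hx.symm.trans h2)
  have htop : isotypicComponent A (LinearMap.ker g) S = ⊤ :=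
    top_le_iff.1 (le_trans (by rw [h.isotypicComponent_coker]; rfl)
      (comap_isotypicComponent_le hk))
  refine (injective_iff_map_eq_zero g).2 fun y hy => ?_
  have h1 : (⟨y, hy⟩ : LinearMap.ker g) ∈ isotypicComponent A (LinearMap.ker g) S :=
    htop ▸ Submodule.mem_top
  exact isotypicComponent_le_ker h.isPerp.hom_eq_zero (LinearMap.ker g).subtype h1

end IsReflection

end Reflection

/-! ### Comparing homological dimensions over `A` and `L(A)`. -/

section Comparison

variable {A : Type u} [Ring A] [IsArtinAlgebra A]
  {S : Type u} [AddCommGroup S] [Module A S] [IsLocalizable A S]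

lemma exists_restriction (Y : Type u) [AddCommGroup Y] [Module (RetractionAlgebra A S) Y] :
    ∃ _ : Module A Y, IsScalarTower A (RetractionAlgebra A S) Y := by
  let : Module A Y := Module.compHom Y (leftRetraction A S)
  refine ⟨inferInstance, ⟨fun a x y => ?_⟩⟩
  have h : a • x = leftRetraction A S a * x := (leftRetraction_smul (perpA A S) a x).symm
  rw [h, mul_smul]
  rfl

section

variable {P Y : Type u} [AddCommGroup P] [Module A P] [AddCommGroup Y] [Module A Y]
  [Module (RetractionAlgebra A S) Y] [IsScalarTower A (RetractionAlgebra A S) Y]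

/-- Restriction preserves surjections, so its left adjoint preserves projectives: lift `η` through a
free cover of `Y`, then extend the lift to `Y`. -/
lemma IsReflection.projective [Module.Projective A P] {η : P →ₗ[A] Y} (h : IsReflection A S η) :
    Module.Projective (RetractionAlgebra A S) Y := by
  have := h.finite
  have : Module.Finite (RetractionAlgebra A S) Y := Module.Finite.of_restrictScalars_finite A _ _
  obtain ⟨n, π, hπ⟩ := Module.Finite.exists_fin' (RetractionAlgebra A S) Y
  obtain ⟨k, hk⟩ := Module.projective_lifting_property (π.restrictScalars A) η hπ
  obtain ⟨σ, hσ⟩ := h.exists_extension (RetractionAlgebra.isPerp.pi n) k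
  have hid : π.restrictScalars A ∘ₗ σ = LinearMap.id := h.hom_ext h.isPerp fun x => by
    rw [LinearMap.comp_apply, hσ]
    exact LinearMap.congr_fun hk x
  exact Module.Projective.of_split (σ.extendScalarsRetraction S) π
    (LinearMap.ext fun y => LinearMap.congr_fun hid y)

end

/-- The reflection functor preserves finite projective dimension. -/
lemma IsReflection.finiteProjDim {X Y : Type u} [AddCommGroup X] [Module A X] [Module.Finite A X]
    [AddCommGroup Y] [Module A Y] [Module (RetractionAlgebra A S) Y]
    [IsScalarTower A (RetractionAlgebra A S) Y] {η : X →ₗ[A] Y} (h : IsReflection A S η)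
    (hX : FiniteProjDim A X) : FiniteProjDim (RetractionAlgebra A S) Y := by
  refine FiniteProjDim.induction (motive := fun X _ _ => ∀ (_ : Module.Finite A X) (Y : Type u)
    [AddCommGroup Y] [Module A Y] [Module (RetractionAlgebra A S) Y]
    [IsScalarTower A (RetractionAlgebra A S) Y] (η : X →ₗ[A] Y), IsReflection A S η →
    FiniteProjDim (RetractionAlgebra A S) Y) ?_ ?_ X hX inferInstance Y η h
  · intro M _ _ _ _ _ Y _ _ _ _ η h
    have := h.projective
    exact .of_projective
  · intro M _ _ _ n π hπ ih _ Y _ _ _ _ η h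
    have := h.finite
    have : Module.Finite (RetractionAlgebra A S) Y :=
      Module.Finite.of_restrictScalars_finite A _ _
    obtain ⟨Y₁, _, _, _, _, _, η₁, h₁⟩ := exists_isReflection A S (LinearMap.ker π)
    obtain ⟨Y₂, _, _, _, _, _, η₂, h₂⟩ := exists_isReflection A S (Fin n → A)
    obtain ⟨f, hf⟩ := h₁.exists_map h₂ (LinearMap.ker π).subtype
    obtain ⟨g, hg⟩ := h₂.exists_map h π
    obtain ⟨hfg, hg'⟩ := h₁.exact_map h₂ h (LinearMap.exact_subtype_ker_map π) hπ hf hg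
    have := h₂.projective
    exact .right (f := f.extendScalarsRetraction S) (g := g.extendScalarsRetraction S)
      (h₁.injective_map h₂ (LinearMap.ker π).subtype_injective hf) hfg hg'
      (ih inferInstance Y₁ η₁ h₁) .of_projective

section

variable (J : Type u) [AddCommGroup J] [Module A J] [Module (RetractionAlgebra A S) J]
  [IsScalarTower A (RetractionAlgebra A S) J] [Module.Finite (RetractionAlgebra A S) J]

/-- Finitely generated `L(A)`-modules are perpendicular to `S`, hence their own reflections. -/
lemma isReflection_id : IsReflection A S (LinearMap.id : J →ₗ[A] J) where
  isPerp := isPerp_of_finite J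
  finite := Module.Finite.trans (RetractionAlgebra A S) J
  existsUnique _ _ _ _ _ f := ⟨f, rfl, fun _ hg => hg⟩

variable (S) in
-- Upwards, `A`-linear extensions are automatically `L(A)`-linear. Downwards, a left ideal of `A` is
-- replaced by its reflection, which still embeds in `L(A)` because reflections preserve injections.
lemma injective_iff_retraction :
    Module.Injective A J ↔ Module.Injective (RetractionAlgebra A S) J := by
  have : Module.Finite A J := Module.Finite.trans (RetractionAlgebra A S) J
  constructor
  · intro h
    refine Module.Baer.injective fun K f => ?_
    obtain ⟨g, hg⟩ := h.out (K.subtype.restrictScalars A) K.subtype_injective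
      (f.restrictScalars A)
    exact ⟨g.extendScalarsRetraction S, fun x hx => hg ⟨x, hx⟩⟩
  · intro h
    refine Module.Baer.injective fun K f => ?_
    obtain ⟨Y, _, _, _, _, _, η, hη⟩ := exists_isReflection A S K
    obtain ⟨f', hf'⟩ := hη.exists_extension (isPerp_of_finite (S := S) J) f
    obtain ⟨j, hj⟩ := hη.exists_map isReflection_etaLinear K.subtype
    obtain ⟨g, hg⟩ := h.out (j.extendScalarsRetraction S)
      (hη.injective_map isReflection_etaLinear K.subtype_injective hj)
      (f'.extendScalarsRetraction S)
    refine ⟨g.restrictScalars A ∘ₗ etaLinear A S, fun x hx => ?_⟩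
    have h1 := hg (η ⟨x, hx⟩)
    have h2 := hj ⟨x, hx⟩
    have h3 := hf' ⟨x, hx⟩
    change g (j (η ⟨x, hx⟩)) = f' (η ⟨x, hx⟩) at h1
    rw [h2, h3] at h1
    exact h1

end

/-- An embedding in a finitely generated injective `L(A)`-module is also one in an injective
`A`-module, so the same cosyzygies serve on both sides. -/
lemma hasInjectiveDimensionLT_iff_retraction (Y : Type u) [AddCommGroup Y] [Module A Y]
    [Module (RetractionAlgebra A S) Y] [IsScalarTower A (RetractionAlgebra A S) Y]
    [Module.Finite (RetractionAlgebra A S) Y] (n : ℕ) :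
    HasInjectiveDimensionLT (ModuleCat.of A Y) (n + 1) ↔
      HasInjectiveDimensionLT (ModuleCat.of (RetractionAlgebra A S) Y) (n + 1) := by
  induction n generalizing Y with
  | zero =>
    rw [zero_add, hasInjectiveDimensionLT_one_iff, hasInjectiveDimensionLT_one_iff]
    exact injective_iff_retraction S Y
  | succ n ih =>
    obtain ⟨W, _, _, _, hW, hemb, -⟩ := exists_injective_cogenerator (RetractionAlgebra A S)
    obtain ⟨k, f, hf⟩ := hemb Y
    obtain ⟨_, _⟩ := exists_restriction (A := A) (S := S) W
    have hWk : Module.Injective (RetractionAlgebra A S) (Fin k → W) := inferInstance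
    have h1 := hasInjectiveDimensionLT_left_iff hf (LinearMap.exact_map_mkQ_range f)
      (LinearMap.range f).mkQ_surjective hWk n
    have h2 := hasInjectiveDimensionLT_left_iff (f := f.restrictScalars A)
      (g := (LinearMap.range f).mkQ.restrictScalars A) hf (LinearMap.exact_map_mkQ_range f)
      (LinearMap.range f).mkQ_surjective ((injective_iff_retraction S _).2 hWk) n
    exact h2.trans ((ih _).trans h1.symm)

lemma finiteInjDim_iff_retraction (Y : Type u) [AddCommGroup Y] [Module A Y]
    [Module (RetractionAlgebra A S) Y] [IsScalarTower A (RetractionAlgebra A S) Y]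
    [Module.Finite (RetractionAlgebra A S) Y] :
    FiniteInjDim A Y ↔ FiniteInjDim (RetractionAlgebra A S) Y := by
  rw [finiteInjDim_iff, finiteInjDim_iff]
  exact exists_congr fun n => hasInjectiveDimensionLT_iff_retraction Y n

section

lemma IsLocalizable.finiteProjDim (A S : Type u) [Ring A] [AddCommGroup S] [Module A S]
    [h : IsLocalizable A S] : FiniteProjDim A S :=
  finiteProjDim_iff.2 ⟨1, (projectiveDimension_le_iff _ 1).1 h.projectiveDimension_le_one⟩

variable (A S)

/-- The kernel and the cokernel of `η_A` are direct sums of copies of `S`. -/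
lemma exists_equiv_ker_coker_etaLinear :
    (∃ m, Nonempty (LinearMap.ker (etaLinear A S) ≃ₗ[A] (Fin m → S))) ∧
      ∃ n, Nonempty ((RetractionAlgebra A S ⧸ LinearMap.range (etaLinear A S)) ≃ₗ[A]
        (Fin n → S)) := by
  have := IsLocalizable.isSimple (A := A) (S := S)
  have h := isReflection_etaLinear (A := A) (S := S)
  constructor
  · rw [h.ker_eq]
    exact exists_isotypicComponent_equiv
  · obtain ⟨n, ⟨e⟩⟩ := exists_isotypicComponent_equiv (A := A) (S := S)
      (X := RetractionAlgebra A S ⧸ LinearMap.range (etaLinear A S))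
    exact ⟨n, ⟨(LinearEquiv.ofTop _ h.isotypicComponent_coker).symm.trans e⟩⟩

/-- `L(A)` is built from `A` and copies of `S`, all of finite projective dimension. -/
lemma finiteProjDim_retractionAlgebra : FiniteProjDim A (RetractionAlgebra A S) := by
  obtain ⟨⟨m, ⟨e⟩⟩, ⟨n, ⟨e'⟩⟩⟩ := exists_equiv_ker_coker_etaLinear A S
  have hS := IsLocalizable.finiteProjDim A S
  have h1 : FiniteProjDim A (LinearMap.range (etaLinear A S)) :=
    .right (LinearMap.ker (etaLinear A S)).subtype_injective
      (g := (etaLinear A S).rangeRestrict) (fun x => by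
        rw [← LinearMap.mem_ker, LinearMap.ker_rangeRestrict]; simp)
      (etaLinear A S).surjective_rangeRestrict ((hS.pi m).congr e) .of_projective
  exact .middle (LinearMap.range (etaLinear A S)).subtype_injective
    (LinearMap.exact_subtype_mkQ _) (Submodule.mkQ_surjective _) h1 ((hS.pi n).congr e')

lemma finiteInjDim_iff_retractionAlgebra (hS : FiniteInjDim A S) :
    FiniteInjDim A A ↔ FiniteInjDim A (RetractionAlgebra A S) := by
  obtain ⟨⟨m, ⟨e⟩⟩, ⟨n, ⟨e'⟩⟩⟩ := exists_equiv_ker_coker_etaLinear A S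
  have hexact : Function.Exact (LinearMap.ker (etaLinear A S)).subtype
      (etaLinear A S).rangeRestrict := fun x => by
    rw [← LinearMap.mem_ker, LinearMap.ker_rangeRestrict]; simp
  have hsurj := (etaLinear A S).surjective_rangeRestrict
  have hinj := (LinearMap.range (etaLinear A S)).subtype_injective
  constructor
  · intro hA
    exact .middle hinj (LinearMap.exact_subtype_mkQ _) (Submodule.mkQ_surjective _)
      (.right (LinearMap.ker (etaLinear A S)).subtype_injective hexact hsurj
        ((hS.pi m).congr e) hA) ((hS.pi n).congr e')
  · intro hL
    exact .middle (LinearMap.ker (etaLinear A S)).subtype_injective hexact hsurj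
      ((hS.pi m).congr e) (.left hinj (LinearMap.exact_subtype_mkQ _)
        (Submodule.mkQ_surjective _) hL ((hS.pi n).congr e'))

end

/-- Restriction along `η_A` preserves finite projective dimension. -/
lemma FiniteProjDim.of_retraction {Y : Type u} [AddCommGroup Y] [Module A Y]
    [Module (RetractionAlgebra A S) Y] [IsScalarTower A (RetractionAlgebra A S) Y]
    [Module.Finite (RetractionAlgebra A S) Y] (hY : FiniteProjDim (RetractionAlgebra A S) Y) :
    FiniteProjDim A Y := by
  refine FiniteProjDim.induction (A := RetractionAlgebra A S) (motive := fun Y _ _ =>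
    ∀ [Module A Y] [IsScalarTower A (RetractionAlgebra A S) Y], FiniteProjDim A Y) ?_ ?_ Y hY
  · intro P _ _ _ _ _ _
    obtain ⟨n, π, hπ⟩ := Module.Finite.exists_fin' (RetractionAlgebra A S) P
    obtain ⟨s, hs⟩ := Module.projective_lifting_property π LinearMap.id hπ
    exact ((finiteProjDim_retractionAlgebra A S).pi n).of_retract (s.restrictScalars A)
      (π.restrictScalars A) (LinearMap.congr_fun hs)
  · intro Y _ _ _ n π hπ ih _ _
    exact .right (f := (LinearMap.ker π).subtype.restrictScalars A) (g := π.restrictScalars A)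
      (LinearMap.ker π).subtype_injective (LinearMap.exact_subtype_ker_map π) hπ ih
      ((finiteProjDim_retractionAlgebra A S).pi n)

end Comparison

/-- Maps `S → I` land in `S` by essentiality, and `Ext¹(S, S) = 0` prevents new maps from `S` to the
quotient; `Ext¹(S, -)` vanishes on quotients of `I`. -/
lemma IsInjectiveEnvelope.isPerp_quotient_range {A : Type u} [Ring A] {S : Type u}
    [AddCommGroup S] [Module A S] [IsLocalizable A S] {I : Type u} [AddCommGroup I] [Module A I]
    {ι : S →ₗ[A] I} (hι : IsInjectiveEnvelope ι) :
    IsPerp A S (I ⧸ LinearMap.range ι) := by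
  have := IsLocalizable.isSimple (A := A) (S := S)
  obtain ⟨p, hp, _, hS⟩ := IsLocalizable.exists_presentation A S
  have hsurj := (LinearMap.range ι).mkQ_surjective
  refine (isPerp_iff hp).2 ⟨hom_eq_zero_of_surjective hp hsurj (fun g s => ?_) ?_,
    (ExtendsFrom.of_injective _ hι.moduleInjective).of_surjective hsurj⟩
  · exact (Submodule.Quotient.mk_eq_zero _).2 (hι.apply_mem_range g s)
  · rw [Submodule.ker_mkQ]
    exact hS.congr (LinearEquiv.ofInjective ι hι.injective)

/-- The reflection of the injective envelope of `S` is the quotient by `S`. -/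
lemma IsInjectiveEnvelope.exact_reflection {A : Type u} [Ring A] {S : Type u}
    [AddCommGroup S] [Module A S] [IsLocalizable A S] {I : Type u} [AddCommGroup I] [Module A I]
    [Module.Finite A I] {ι : S →ₗ[A] I} (hι : IsInjectiveEnvelope ι) {Y : Type u}
    [AddCommGroup Y] [Module A Y] {η : I →ₗ[A] Y} (h : IsReflection A S η) :
    Function.Exact ι η ∧ Function.Surjective η := by
  have := h.finite
  obtain ⟨e, he⟩ := h.exists_extension hι.isPerp_quotient_range (LinearMap.range ι).mkQ
  have hηι : η ∘ₗ ι = 0 := h.isPerp.hom_eq_zero _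
  have hle : LinearMap.range ι ≤ LinearMap.ker η := by
    rintro _ ⟨s, rfl⟩
    exact LinearMap.congr_fun hηι s
  constructor
  · refine fun x => ⟨fun hx => ?_, fun hx => hle hx⟩
    have := he x
    rw [hx, map_zero] at this
    exact (Submodule.Quotient.mk_eq_zero _).1 this.symm
  -- The map `I ⧸ S → Y` induced by `η` has `e` as a right inverse, so `η` is onto.
  · have hid : (LinearMap.range ι).liftQ η hle ∘ₗ e = LinearMap.id :=
      h.hom_ext h.isPerp fun x => by
        rw [LinearMap.comp_apply, he]
        rfl
    intro y
    obtain ⟨x, hx⟩ := (LinearMap.range ι).mkQ_surjective (e y)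
    refine ⟨x, ?_⟩
    have := LinearMap.congr_fun hid y
    rw [LinearMap.comp_apply, ← hx] at this
    exact this

/-! ### The Gorenstein criterion. -/

section Main

variable {A : Type u} [Ring A] [IsArtinAlgebra A]
  {S : Type u} [AddCommGroup S] [Module A S] [IsLocalizable A S]
  {I : Type u} [AddCommGroup I] [Module A I] [Module.Finite A I] {ι : S →ₗ[A] I}

lemma isGorenstein_iff (hι : IsInjectiveEnvelope ι) {Y : Type u} [AddCommGroup Y] [Module A Y]
    [Module (RetractionAlgebra A S) Y] [IsScalarTower A (RetractionAlgebra A S) Y]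
    {η : I →ₗ[A] Y} (h : IsReflection A S η) :
    IsGorenstein A ↔
      IsGorenstein (RetractionAlgebra A S) ∧ FiniteProjDim (RetractionAlgebra A S) Y := by
  have := IsLocalizable.isSimple (A := A) (S := S)
  have := h.finite
  have : Module.Finite (RetractionAlgebra A S) Y := Module.Finite.of_restrictScalars_finite A _ _
  obtain ⟨hexact, hsurj⟩ := hι.exact_reflection h
  obtain ⟨W, _, _, _, hW, hembW, hdualW⟩ := exists_injective_cogenerator A
  obtain ⟨V, _, _, _, hV, hembV, hdualV⟩ :=
    exists_injective_cogenerator (RetractionAlgebra A S)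
  obtain ⟨_, _⟩ := exists_restriction (A := A) (S := S) V
  have : Module.Finite A V := Module.Finite.trans (RetractionAlgebra A S) V
  have hVA : Module.Injective A V := (injective_iff_retraction S V).2 hV
  have hpdS := IsLocalizable.finiteProjDim A S
  -- Every finitely generated injective is a direct summand of a power of `W`.
  have hinj {J : Type u} [AddCommGroup J] [Module A J] [Module.Finite A J]
      (hJ : Module.Injective A J) (hpd : FiniteProjDim A W) : FiniteProjDim A J := by
    obtain ⟨n, f, hf⟩ := hembW J
    obtain ⟨r, hr⟩ := hJ.exists_retraction hf
    exact (hpd.pi n).of_retract f r hr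
  constructor
  · rintro ⟨hl : FiniteInjDim A A, hr : FiniteInjDim Aᵐᵒᵖ A⟩
    rw [hdualW] at hr
    have hidS : FiniteInjDim A S := .of_finiteProjDim hl S hpdS
    refine ⟨⟨?_, ?_⟩, h.finiteProjDim (hinj hι.moduleInjective hr)⟩
    · exact (finiteInjDim_iff_retraction (A := A) _).1
        ((finiteInjDim_iff_retractionAlgebra A S hidS).1 hl)
    -- `V` is injective over `A` and is its own reflection.
    · exact hdualV.2 ((isReflection_id V).finiteProjDim (hinj hVA hr))
  · rintro ⟨⟨hl : FiniteInjDim (RetractionAlgebra A S) (RetractionAlgebra A S),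
      hr : FiniteInjDim (RetractionAlgebra A S)ᵐᵒᵖ (RetractionAlgebra A S)⟩, hY⟩
    rw [hdualV] at hr
    have hidS : FiniteInjDim A S := .left hι.injective hexact hsurj
      (.of_injective hι.moduleInjective)
      ((finiteInjDim_iff_retraction Y).2 (.of_finiteProjDim hl Y hY))
    refine ⟨(finiteInjDim_iff_retractionAlgebra A S hidS).2
      ((finiteInjDim_iff_retraction _).2 hl), hdualW.2 ?_⟩
    have hpdI : FiniteProjDim A I := .middle hι.injective hexact hsurj hpdS hY.of_retraction
    -- `W` embeds into the sum of a power of `V` and a power of `I`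
    obtain ⟨Y', _, _, _, _, _, η', h'⟩ := exists_isReflection A S W
    obtain ⟨n, f, hf⟩ := hembV Y'
    obtain ⟨m, ⟨e⟩⟩ := exists_isotypicComponent_equiv (A := A) (S := S) (X := W)
    let ιm : (Fin m → S) →ₗ[A] (Fin m → I) := LinearMap.pi fun i => ι ∘ₗ LinearMap.proj i
    have hιm : Function.Injective ιm := fun x y hxy =>
      funext fun i => hι.injective (congrFun hxy i)
    have := hι.moduleInjective
    have hIm : Module.Injective A (Fin m → I) := inferInstance
    -- The kernel of `η'` is a power `S^m`; its embedding in `I^m` extends to `W`, and this second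
    -- coordinate detects exactly what `η'` loses.
    obtain ⟨g, hg⟩ := hIm.out (isotypicComponent A W S).subtype
      (isotypicComponent A W S).subtype_injective (ιm ∘ₗ e.toLinearMap)
    let k : W →ₗ[A] (Fin n → V) × (Fin m → I) := ((f.restrictScalars A) ∘ₗ η').prod g
    have hk : Function.Injective k := by
      refine (injective_iff_map_eq_zero k).2 fun w hw => ?_
      have h1 : f (η' w) = 0 := congrArg Prod.fst hw
      have h2 : g w = 0 := congrArg Prod.snd hw
      have hw' : w ∈ isotypicComponent A W S := by
        rw [← h'.ker_eq]
        exact hf (h1.trans (map_zero f).symm)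
      have h3 := hg ⟨w, hw'⟩
      rw [Submodule.subtype_apply, h2] at h3
      have h4 : e ⟨w, hw'⟩ = e 0 := (hιm ((map_zero ιm).trans h3)).symm.trans (map_zero e).symm
      exact congrArg Subtype.val (e.injective h4)
    obtain ⟨r, hr'⟩ := hW.exists_retraction hk
    exact ((hr.of_retraction.pi n).prod (hpdI.pi m)).of_retract k r hr'

end Main

theorem mainTheorem3 (A : Type u) [Ring A] [IsArtinAlgebra A]
    (S : Type u) [AddCommGroup S] [Module A S] [IsLocalizable A S]
    (I : Type u) [AddCommGroup I] [Module A I] [Module.Finite A I]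
    (ι : S →ₗ[A] I) (hι : IsInjectiveEnvelope ι) :
    IsGorenstein A ↔
      IsGorenstein (RetractionAlgebra A S) ∧
        projectiveDimension
          ((perpToModule A S).obj ((iLambda A S).obj (FGModuleCat.of A I))) < ⊤ :=
  isGorenstein_iff (Y := ((iLambda A S).obj (FGModuleCat.of A I)).obj) hι
    (isReflection_perpUnit (FGModuleCat.of A I))
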